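/- Let $|\cdot|$ be the Euclidean norm on $\mathbb R^n$. For a probability measure $\mu$ on $\mathbb R^n$ and measurable $f:\mathbb R^n\to\mathbb R$ let $$\|f\|_{\Psi_2(\mu)}=\inf\Big\{s>0:\int e^{f^2/s^2}\,d\mu\le 2\Big\}\in[0,\infty],\qquad \sigma_{SG}(\mu)=\sup_{|\theta|=1}\big\|\langle x-b_\mu,\theta\rangle\big\|_{\Psi_2(\mu)},$$ where $b_\mu=\int x\,d\mu$ is the barycenter, and let $L(\mu)=\big\|\,|x|-\int|y|\,d\mu(y)\,\big\|_{\Psi_2(\mu)}$. A measure is log-concave if it has a density $e^{-V}$ with respect to Lebesgue measure with $V:\mathbb R^n\to\mathbb R\cup\{+\infty\}$ convex. For $t\ge 0$ let $\nu_t=\frac1{Z_t}e^{-t|x|^2}\nu$, the normalizing constant $Z_t$ making it a probability measure. We write $1/t=+\infty$ for $t=0$. (1) There is a universal constant $C>0$ such that for every $n$, every centered log-concave probability measure $\nu$ on $\mathbb R^n$ with $\int|x|^2\,d\nu=n$ and every $t\ge0$, $$\|\mathrm{Cov}(\nu_t)\|_{op}\le\sigma_{SG}^2(\nu_t)\le C\min\Big(\sigma_{SG}^2(\nu)\big(1+t^2\,n\,L(\nu)^2\big),\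 \frac1t\Big).$$ (2) This cannot be improved in general, even if $\sigma_{SG}^2(\nu_t)$ is replaced with the smaller quantity $\|\mathrm{Cov}(\nu_t)\|_{op}$: there are universal constants $c,C>0$ such that for every $n\ge1$ there is a compact convex set $K\subset\mathbb R^n$ with nonempty interior whose uniform probability measure $\nu$ is log-concave, centered, satisfies $\int|x|^2\,d\nu=n$, $\sigma_{SG}^2(\nu)\le C$ and $L(\nu)^2\le C$, and is such that for all $t\ge0$ $$\|\mathrm{Cov}(\nu_t)\|_{op}\ \ge\ c\,\min\Big(\sigma_{SG}^2(\nu)\big(1+t^2\,n\,L(\nu)^2\big),\ \frac1t\Big)\quad\text{and}\quad \|\mathrm{Cov}(\nu_t)\|_{op}\ \ge\ c\,\min\Big(1+t^2n,\ \frac1t\Big).$$ -/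

import Mathlib

open MeasureTheory ProbabilityTheory
open scoped ENNReal

noncomputable section

/-- A measure on `ℝⁿ` is log-concave if it has a density `exp (-V)` with respect to Lebesgue
measure, `V : ℝⁿ → ℝ ∪ {+∞}` convex. Such a `V` is given by its convex domain of finiteness `D` and
its (convex, real-valued) restriction to `D`; the density vanishes off `D`. -/
def IsLogConcave {n : ℕ} (μ : Measure (EuclideanSpace ℝ (Fin n))) : Prop :=
  ∃ (D : Set (EuclideanSpace ℝ (Fin n))) (V : EuclideanSpace ℝ (Fin n) → ℝ),
    ConvexOn ℝ D V ∧
      μ = volume.withDensity (D.indicator fun x => ENNReal.ofReal (Real.exp (-V x)))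

/-- The `Ψ₂` norm `inf {s > 0 | 𝔼 exp (f² / s²) ≤ 2}` of a real random variable `f`, with value
`∞` if there is no such `s` (that is, if `f` is not sub-gaussian). -/
def psi2Norm {Ω : Type*} [MeasurableSpace Ω] (f : Ω → ℝ) (μ : Measure Ω) : ℝ≥0∞ :=
  ⨅ (s : ℝ) (_ : 0 < s) (_ : ∫⁻ x, ENNReal.ofReal (Real.exp (f x ^ 2 / s ^ 2)) ∂μ ≤ 2),
    ENNReal.ofReal s

/-- The sub-gaussian constant of a measure with barycenter `b`: the supremum over unit vectors `θ`
of the `Ψ₂` norm of `⟨x - b, θ⟩`. -/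
def sigmaSG {n : ℕ} (μ : Measure (EuclideanSpace ℝ (Fin n))) : ℝ≥0∞ :=
  ⨆ θ ∈ Metric.sphere (0 : EuclideanSpace ℝ (Fin n)) 1,
    psi2Norm (fun x => inner ℝ (x - ∫ y, y ∂μ) θ) μ

/-- The `Ψ₂` norm of `|X| - 𝔼|X|`, for `X` distributed according to `μ`. -/
def normDeviation {n : ℕ} (μ : Measure (EuclideanSpace ℝ (Fin n))) : ℝ≥0∞ :=
  psi2Norm (fun x => ‖x‖ - ∫ y, ‖y‖ ∂μ) μ

/-- The probability measure proportional to `exp (-t|x|²) μ`. -/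
def gaussianTilt {n : ℕ} (μ : Measure (EuclideanSpace ℝ (Fin n))) (t : ℝ) :
    Measure (EuclideanSpace ℝ (Fin n)) :=
  μ.tilted fun x => -(t * ‖x‖ ^ 2)

/-- The operator norm of the covariance matrix of `μ`, as the norm of the bilinear form
`(u, v) ↦ Cov (⟨X, u⟩, ⟨X, v⟩)`. -/
def covOpNorm {n : ℕ} (μ : Measure (EuclideanSpace ℝ (Fin n))) : ℝ≥0∞ :=
  ‖covarianceBilin μ‖ₑ

end

/-! The inequality between covariance and sub-Gaussian constant is Jensen's: `2 ≤ e`, so a variable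
whose `Ψ₂` norm is below `r` has second moment at most `r ^ 2`.

The bound by `1 / t` comes from Prékopa–Leindler. Multiplying a log-concave density by `exp
(-t|x|²)` produces, through the parallelogram identity, a gain `exp (t|x-y|²/2)` in the midpoint
inequality. Hence `φ x - ψ y ≤ t|x-y|²/2` implies `∫ exp φ * ∫ exp (-ψ) ≤ 1` for the tilted measure
(`IsLogConcave.lintegral_exp_mul_lintegral_exp_neg_le_one`). Linear `φ, ψ` bound the variance of a
linear functional by a multiple of `1 / t`; quadratic ones then upgrade this to a `Ψ₂` bound.

The bound by `σ²(1 + t²nL²)` needs no log-concavity (`sigmaSG_gaussianTilt_le`). Write `|x| = R + ξ`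
with `R = 𝔼|x|`. Up to the factor `exp (-tR²)`, the tilt is at most `exp (-2tRξ)`, which the `Ψ₂`
bound on `ξ` controls at the cost `exp (O(t²nL²))`; the normalizing constant is at least `exp (-tn)`
by Jensen. A bound `𝔼 exp (f²/s²) ≤ exp a` costs only a factor of order `√a` in the `Ψ₂` norm.

For tightness, the body `coneBody m` lies over the cube `[-1, 1]^m`, with a fibre of half-width `3 +
S(y)`, where `S` is the normalized sum of the `1/3 - y_i²`. The function `S` is concave, so the body
is convex. Under the uniform measure on the cube `S` is centred and sub-Gaussian at scale one, so
`σ` and `L` are bounded. Tilting makes the `y_i` independent truncated Gaussians before the fibre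
weight is taken into account; the mean of `S` then grows like `t√n` for `t ≤ 1`, while its variance
stays at most one. The fibre coordinate thus spreads over a width `1 + t√n`, cut only by `exp
(-tu²)` at scale `1/√t`, so its second moment is at least of order `min (1 + t²n, 1/t)`
(`ofReal_le_lintegral_sq_coneBody`). A dilation by a universally bounded factor normalizes the
second moment to `n`. -/

open scoped Pointwise

/-! ### The Prékopa–Leindler inequality -/

/-- One-dimensional Brunn–Minkowski inequality for midpoints of compact sets. -/
lemma volume_add_volume_le_of_isCompact {A B S : Set ℝ} (hA : IsCompact A) (hB : IsCompact B)
    (hA' : A.Nonempty) (hB' : B.Nonempty) (h : ∀ a ∈ A, ∀ b ∈ B, a + b ∈ S) :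
    volume A + volume B ≤ volume S := by
  obtain ⟨m, hmA, hm⟩ := hA.exists_isGreatest hA'
  obtain ⟨p, hpB, hp⟩ := hB.exists_isLeast hB'
  -- The translate `A + min B` ends at `m + p`, exactly where the translate `max A + B` begins, so
  -- the two overlap in at most one point.
  have h1 : volume ((fun x => x + p) '' A) = volume A := by
    rw [Set.image_add_right, measure_preimage_add_right]
  have h2 : volume ((fun x => m + x) '' B) = volume B := by
    rw [Set.image_add_left, measure_preimage_add]
  have hd : AEDisjoint volume ((fun x => x + p) '' A) ((fun x => m + x) '' B) := by
    refine measure_mono_null (t := {m + p}) ?_ (by simp)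
    rintro _ ⟨⟨a, ha, rfl⟩, ⟨b, hb, hab⟩⟩
    have := hm ha
    have := hp hb
    simp only [Set.mem_singleton_iff] at *
    linarith
  rw [← h1, ← h2, ← measure_union₀ _ hd]
  · refine measure_mono ?_
    rintro _ (⟨a, ha, rfl⟩ | ⟨b, hb, rfl⟩)
    · exact h a ha p hpB
    · exact h m hmA b hb
  · exact (hB.image (by fun_prop)).measurableSet.nullMeasurableSet

lemma volume_add_volume_le {A B S : Set ℝ} (hA : MeasurableSet A) (hB : MeasurableSet B)
    (hA' : A.Nonempty) (hB' : B.Nonempty) (h : ∀ a ∈ A, ∀ b ∈ B, a + b ∈ S) :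
    volume A + volume B ≤ volume S := by
  obtain ⟨a₀, ha₀⟩ := hA'
  obtain ⟨b₀, hb₀⟩ := hB'
  rw [hA.measure_eq_iSup_isCompact, hB.measure_eq_iSup_isCompact]
  simp only [iSup_and']
  refine ENNReal.biSup_add_biSup_le' (p := fun K => K ⊆ A ∧ IsCompact K)
    (q := fun K => K ⊆ B ∧ IsCompact K) ⟨∅, by simp⟩ ⟨∅, by simp⟩ ?_
  rintro K ⟨hKA, hK⟩ L ⟨hLB, hL⟩
  -- The approximating compact sets may be empty; inserting a point restores the nonemptiness that
  -- the compact case needs.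
  refine le_trans (add_le_add (measure_mono (Set.subset_insert a₀ K))
    (measure_mono (Set.subset_insert b₀ L))) ?_
  refine volume_add_volume_le_of_isCompact (hK.insert _) (hL.insert _) (by simp) (by simp) ?_
  exact fun a ha b hb => h a (Set.insert_subset ha₀ hKA ha) b (Set.insert_subset hb₀ hLB hb)

lemma volume_add_volume_le_two_mul {A B S : Set ℝ} (hA : MeasurableSet A) (hB : MeasurableSet B)
    (hA' : A.Nonempty) (hB' : B.Nonempty) (h : ∀ a ∈ A, ∀ b ∈ B, midpoint ℝ a b ∈ S) :
    volume A + volume B ≤ 2 * volume S := by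
  have : volume ((2 : ℝ) • S) = 2 * volume S := by
    rw [Measure.addHaar_smul]; simp
  rw [← this]
  refine volume_add_volume_le hA hB hA' hB' fun a ha b hb => ?_
  refine ⟨_, h a ha b hb, ?_⟩
  simp [midpoint_eq_smul_add]

lemma ENNReal.mul_le_sq_of_add_le {x y z : ℝ≥0∞} (h : x + y ≤ 2 * z) : x * y ≤ z ^ 2 := by
  by_cases hz : z = ⊤
  · simp [hz]
  lift z to NNReal using hz
  have hxy : x + y ≠ ⊤ := ne_top_of_le_ne_top (by finiteness) h
  have hx : x ≠ ⊤ := by rintro rfl; simp at hxy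
  have hy : y ≠ ⊤ := by rintro rfl; simp at hxy
  lift x to NNReal using hx
  lift y to NNReal using hy
  norm_cast at h ⊢
  have h' : (x : ℝ) + y ≤ 2 * z := by exact_mod_cast h
  have : (x : ℝ) * y ≤ z ^ 2 := by nlinarith [sq_nonneg ((x : ℝ) - y), x.2, y.2, z.2]
  exact_mod_cast this

/-- The midpoint form of the Prékopa–Leindler inequality for a measure. -/
def IsPrekopaLeindler {E : Type*} [AddCommGroup E] [Module ℝ E] [MeasurableSpace E]
    (μ : Measure E) : Prop :=
  ∀ f g h : E → ℝ≥0∞, Measurable f → Measurable g → Measurable h →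
    (∀ x y, f x * g y ≤ h (midpoint ℝ x y) ^ 2) →
    (∫⁻ x, f x ∂μ) * ∫⁻ x, g x ∂μ ≤ (∫⁻ x, h x ∂μ) ^ 2

/-- With both suprema equal to `1`, the superlevel sets of `f` and `g` are nonempty for the same
range `τ < 1`. Midpoints of `{f > τ}` and `{g > τ}` lie in `{h > τ}`, so one-dimensional
Brunn–Minkowski applies level by level in the layer-cake formula. -/
lemma lintegral_add_le_of_iSup_eq_one {f g h : ℝ → ℝ} (hf : Measurable f) (hg : Measurable g)
    (hh : Measurable h) (hf0 : 0 ≤ f) (hg0 : 0 ≤ g) (hh0 : 0 ≤ h)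
    (hf1 : IsLUB (Set.range f) 1) (hg1 : IsLUB (Set.range g) 1)
    (H : ∀ x y, f x * g y ≤ h (midpoint ℝ x y) ^ 2) :
    (∫⁻ x, ENNReal.ofReal (f x)) + ∫⁻ x, ENNReal.ofReal (g x) ≤
      2 * ∫⁻ x, ENNReal.ofReal (h x) := by
  rw [lintegral_eq_lintegral_meas_lt _ (ae_of_all _ hf0) hf.aemeasurable,
    lintegral_eq_lintegral_meas_lt _ (ae_of_all _ hg0) hg.aemeasurable,
    lintegral_eq_lintegral_meas_lt _ (ae_of_all _ hh0) hh.aemeasurable,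
    ← lintegral_const_mul' _ _ (by simp)]
  have hanti : Antitone fun τ : ℝ => volume {a | τ < f a} :=
    fun s t hst => measure_mono fun a (ha : t < f a) => lt_of_le_of_lt hst ha
  rw [← lintegral_add_left hanti.measurable]
  refine setLIntegral_mono' measurableSet_Ioi fun τ (hτ : 0 < τ) => ?_
  by_cases h1 : τ < 1
  · obtain ⟨_, ⟨a, rfl⟩, ha⟩ := (lt_isLUB_iff hf1).1 h1
    obtain ⟨_, ⟨b, rfl⟩, hb⟩ := (lt_isLUB_iff hg1).1 h1
    refine volume_add_volume_le_two_mul (measurableSet_lt measurable_const hf)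
      (measurableSet_lt measurable_const hg) ⟨a, ha⟩ ⟨b, hb⟩ fun x (hx : τ < f x) y (hy : τ < g y) => ?_
    have := H x y
    have h2 : τ * τ < f x * g y := by gcongr
    exact lt_of_pow_lt_pow_left₀ 2 (hh0 _) (by nlinarith)
  · have e1 : {a | τ < f a} = ∅ := by
      ext a
      have := hf1.1 ⟨a, rfl⟩
      simp only [Set.mem_ofPred_eq, Set.mem_empty_iff_false, iff_false]; linarith
    have e2 : {a | τ < g a} = ∅ := by
      ext a
      have := hg1.1 ⟨a, rfl⟩
      simp only [Set.mem_ofPred_eq, Set.mem_empty_iff_false, iff_false]; linarith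
    simp [e1, e2]

/-- By homogeneity one may divide `f`, `g` by their suprema `a`, `b` and `h` by `√(ab)`. The
additive inequality for the normalized functions then gives the multiplicative one by the
arithmetic-geometric mean inequality. -/
lemma lintegral_mul_lintegral_le_of_bddAbove {f g h : ℝ → ℝ} (hf : Measurable f)
    (hg : Measurable g) (hh : Measurable h) (hf0 : 0 ≤ f) (hg0 : 0 ≤ g) (hh0 : 0 ≤ h)
    (hf1 : BddAbove (Set.range f)) (hg1 : BddAbove (Set.range g))
    (H : ∀ x y, f x * g y ≤ h (midpoint ℝ x y) ^ 2) :
    (∫⁻ x, ENNReal.ofReal (f x)) * ∫⁻ x, ENNReal.ofReal (g x) ≤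
      (∫⁻ x, ENNReal.ofReal (h x)) ^ 2 := by
  have key : ∀ f : ℝ → ℝ, 0 ≤ f → BddAbove (Set.range f) →
      f = 0 ∨ ∃ a, 0 < a ∧ IsLUB (Set.range fun x => a⁻¹ * f x) 1 := by
    intro f hf0 hf1
    by_cases hfz : f = 0
    · exact Or.inl hfz
    right
    obtain ⟨x, hx⟩ : ∃ x, f x ≠ 0 := by
      by_contra! hx
      exact hfz (funext hx)
    have hl := isLUB_ciSup hf1
    have hpos : 0 < ⨆ x, f x := lt_of_lt_of_le (lt_of_le_of_ne (hf0 x) hx.symm) (le_ciSup hf1 x)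
    refine ⟨_, hpos, ?_⟩
    have := hl.mul_left (inv_nonneg.2 hpos.le)
    rw [inv_mul_cancel₀ hpos.ne', ← Set.range_comp] at this
    exact this
  rcases key f hf0 hf1 with rfl | ⟨a, ha, hfa⟩
  · simp
  rcases key g hg0 hg1 with rfl | ⟨b, hb, hgb⟩
  · simp
  set c := √(a * b) with hc
  have hc0 : 0 < c := Real.sqrt_pos.2 (mul_pos ha hb)
  have hc2 : c ^ 2 = a * b := Real.sq_sqrt (mul_pos ha hb).le
  have := lintegral_add_le_of_iSup_eq_one (f := fun x => a⁻¹ * f x) (g := fun x => b⁻¹ * g x)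
    (h := fun x => c⁻¹ * h x) (by fun_prop) (by fun_prop) (by fun_prop)
    (fun x => mul_nonneg (inv_nonneg.2 ha.le) (hf0 x))
    (fun x => mul_nonneg (inv_nonneg.2 hb.le) (hg0 x))
    (fun x => mul_nonneg (inv_nonneg.2 hc0.le) (hh0 x)) hfa hgb fun x y => by
      rw [mul_pow, inv_pow, hc2, mul_inv]
      calc a⁻¹ * f x * (b⁻¹ * g y) = a⁻¹ * b⁻¹ * (f x * g y) := by ring
        _ ≤ _ := by gcongr; exact H x y
  have := ENNReal.mul_le_sq_of_add_le this
  have e : ∀ {a : ℝ} (f : ℝ → ℝ), 0 < a → ∫⁻ x, ENNReal.ofReal (a⁻¹ * f x) =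
      (ENNReal.ofReal a)⁻¹ * ∫⁻ x, ENNReal.ofReal (f x) := by
    intro a f ha
    rw [← lintegral_const_mul' _ _ (by simp [ha])]
    simp_rw [ENNReal.ofReal_mul (inv_nonneg.2 ha.le), ENNReal.ofReal_inv_of_pos ha]
  rw [e f ha, e g hb, e h hc0, mul_pow, ← ENNReal.inv_pow, ← ENNReal.ofReal_pow hc0.le, hc2,
    ENNReal.ofReal_mul ha.le, ENNReal.mul_inv (by simp [ha]) (by simp)] at this
  set A := ENNReal.ofReal a
  set B := ENNReal.ofReal b
  have hA : A ≠ 0 := by simp [A, ha]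
  have hB : B ≠ 0 := by simp [B, hb]
  have h2 : (A * B) * (A⁻¹ * (∫⁻ x, ENNReal.ofReal (f x)) * (B⁻¹ * ∫⁻ x, ENNReal.ofReal (g x))) ≤
    (A * B) * (A⁻¹ * B⁻¹ * (∫⁻ x, ENNReal.ofReal (h x)) ^ 2) := by gcongr
  have e1 : ∀ u v : ℝ≥0∞, (A * B) * (A⁻¹ * u * (B⁻¹ * v)) = u * v := fun u v => by
    calc (A * B) * (A⁻¹ * u * (B⁻¹ * v)) = (A * A⁻¹) * (B * B⁻¹) * (u * v) := by ring
      _ = _ := by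
        rw [ENNReal.mul_inv_cancel hA (by simp [A]), ENNReal.mul_inv_cancel hB (by simp [B])]; simp
  have e2 : ∀ w : ℝ≥0∞, (A * B) * (A⁻¹ * B⁻¹ * w) = w := fun w => by
    simpa [mul_assoc] using e1 1 w
  rwa [e1, e2] at h2

lemma isPrekopaLeindler_real : IsPrekopaLeindler (volume : Measure ℝ) := by
  intro f g h hf hg hh H
  have hlim : ∀ f : ℝ → ℝ≥0∞, Measurable f →
      ∫⁻ x, f x = ⨆ k : ℕ, ∫⁻ x, min (f x) k := by
    intro f hf
    rw [← lintegral_iSup (fun k => hf.min measurable_const)]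
    · congr with x
      rw [← inf_iSup_eq, ENNReal.iSup_natCast, inf_top_eq]
    · intro k l hkl x
      exact min_le_min le_rfl (by exact_mod_cast hkl)
  rw [hlim f hf, hlim g hg, ENNReal.iSup_mul]
  refine iSup_le fun k => ?_
  rw [ENNReal.mul_iSup]
  refine iSup_le fun l => ?_
  set c : ℝ≥0∞ := max k l
  have hc : c ≠ ⊤ := by simp [c]
  have hfin : ∀ (f : ℝ → ℝ≥0∞) (c : ℝ≥0∞), c ≠ ⊤ → ∀ x, min (f x) c ≠ ⊤ := fun f c hc x =>
    ne_top_of_le_ne_top hc (min_le_right _ _)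
  have e : ∀ (f : ℝ → ℝ≥0∞) (c : ℝ≥0∞), c ≠ ⊤ → ∫⁻ x, min (f x) c =
      ∫⁻ x, ENNReal.ofReal (min (f x) c).toReal := fun f c hc =>
    lintegral_congr fun x => (ENNReal.ofReal_toReal (hfin f c hc x)).symm
  have hb : ∀ (f : ℝ → ℝ≥0∞) (c : ℝ≥0∞), c ≠ ⊤ →
      BddAbove (Set.range fun x => (min (f x) c).toReal) := fun f c hc => by
    refine ⟨c.toReal, ?_⟩
    rintro _ ⟨x, rfl⟩
    exact ENNReal.toReal_mono hc (min_le_right _ _)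
  calc (∫⁻ x, min (f x) k) * ∫⁻ x, min (g x) l ≤ (∫⁻ x, min (h x) c) ^ 2 := by
        rw [e f k (by simp), e g l (by simp), e h c hc]
        refine lintegral_mul_lintegral_le_of_bddAbove (by fun_prop) (by fun_prop) (by fun_prop)
          (fun _ => ENNReal.toReal_nonneg) (fun _ => ENNReal.toReal_nonneg)
          (fun _ => ENNReal.toReal_nonneg) (hb _ _ (by simp)) (hb _ _ (by simp)) fun x y => ?_
        rw [← ENNReal.toReal_mul, ← ENNReal.toReal_pow]
        refine ENNReal.toReal_mono (ENNReal.pow_ne_top (hfin _ _ hc _)) ?_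
        rcases le_total (h (midpoint ℝ x y)) c with h1 | h1
        · rw [min_eq_left h1]
          exact (mul_le_mul' (min_le_left _ _) (min_le_left _ _)).trans (H x y)
        · rw [min_eq_right h1, sq]
          exact mul_le_mul' ((min_le_right _ _).trans (le_max_left _ _))
            ((min_le_right _ _).trans (le_max_right _ _))
    _ ≤ _ := by
        gcongr
        exact min_le_left _ _

/-- Tensorization: the inequality on the fibres says precisely that the fibre integrals satisfy the
hypothesis on the base. -/
lemma IsPrekopaLeindler.prod {E F : Type*} [AddCommGroup E] [Module ℝ E] [MeasurableSpace E]
    [AddCommGroup F] [Module ℝ F] [MeasurableSpace F] {μ : Measure E} {ν : Measure F} [SFinite ν]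
    (hμ : IsPrekopaLeindler μ) (hν : IsPrekopaLeindler ν) : IsPrekopaLeindler (μ.prod ν) := by
  intro f g h hf hg hh H
  rw [lintegral_prod _ hf.aemeasurable, lintegral_prod _ hg.aemeasurable,
    lintegral_prod _ hh.aemeasurable]
  refine hμ _ _ _ hf.lintegral_prod_right' hg.lintegral_prod_right' hh.lintegral_prod_right'
    fun x y => ?_
  refine hν _ _ _ (by fun_prop) (by fun_prop) (by fun_prop) fun u v => ?_
  simpa [midpoint_eq_smul_add] using H (x, u) (y, v)

lemma IsPrekopaLeindler.of_measurePreserving {E F : Type*} [AddCommGroup E] [Module ℝ E]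
    [MeasurableSpace E] [AddCommGroup F] [Module ℝ F] [MeasurableSpace F] {μ : Measure E}
    {ν : Measure F} (hμ : IsPrekopaLeindler μ) {e : E → F} (he : MeasurePreserving e μ ν)
    (hmid : ∀ x y, e (midpoint ℝ x y) = midpoint ℝ (e x) (e y)) : IsPrekopaLeindler ν := by
  intro f g h hf hg hh H
  rw [← he.lintegral_comp hf, ← he.lintegral_comp hg, ← he.lintegral_comp hh]
  refine hμ _ _ _ (hf.comp he.measurable) (hg.comp he.measurable) (hh.comp he.measurable)
    fun x y => ?_
  rw [hmid]
  exact H _ _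

lemma isPrekopaLeindler_pi (n : ℕ) : IsPrekopaLeindler (volume : Measure (Fin n → ℝ)) := by
  induction n with
  | zero =>
    intro f g h hf hg hh H
    rw [volume_pi, Measure.pi_of_empty _ 0, lintegral_dirac' _ hf, lintegral_dirac' _ hg, lintegral_dirac' _ hh]
    simpa using H 0 0
  | succ n ih =>
    refine IsPrekopaLeindler.of_measurePreserving (isPrekopaLeindler_real.prod ih)
      ((volume_preserving_piFinSuccAbove (fun _ : Fin (n + 1) => ℝ) 0).symm _) fun x y => ?_
    ext i
    refine Fin.cases ?_ (fun j => ?_) i <;>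
      simp [midpoint_eq_smul_add, MeasurableEquiv.piFinSuccAbove_symm_apply, mul_add]

lemma isPrekopaLeindler_euclideanSpace (n : ℕ) :
    IsPrekopaLeindler (volume : Measure (EuclideanSpace ℝ (Fin n))) :=
  (isPrekopaLeindler_pi n).of_measurePreserving
    (EuclideanSpace.volume_preserving_symm_measurableEquiv_toLp (Fin n)).symm fun x y => by
      ext i
      simp [midpoint_eq_smul_add]

/-! ### Calculus of the `Ψ₂` norm -/

section Psi2

variable {Ω : Type*} [MeasurableSpace Ω] {μ : Measure Ω} {f : Ω → ℝ}

lemma psi2Norm_le_ofReal {s : ℝ} (hs : 0 < s)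
    (h : ∫⁻ x, ENNReal.ofReal (Real.exp (f x ^ 2 / s ^ 2)) ∂μ ≤ 2) :
    psi2Norm f μ ≤ ENNReal.ofReal s :=
  iInf_le_of_le s (iInf_le_of_le hs (iInf_le_of_le h le_rfl))

/-- The strict inequality supplies an admissible `s < r`, so attainment of the infimum is never an
issue. -/
lemma lintegral_exp_sq_div_le_two {r : ℝ} (h : psi2Norm f μ < ENNReal.ofReal r) :
    ∫⁻ x, ENNReal.ofReal (Real.exp (f x ^ 2 / r ^ 2)) ∂μ ≤ 2 := by
  simp only [psi2Norm, iInf_lt_iff] at h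
  obtain ⟨s, hs, h, hsr⟩ := h
  have hsr : s < r := ENNReal.ofReal_lt_ofReal_iff_of_nonneg hs.le |>.1 hsr
  refine le_trans (lintegral_mono fun x => ?_) h
  gcongr

/-- Jensen's inequality for the exponential, in tangent line form. -/
lemma integral_le_of_lintegral_exp_le [IsProbabilityMeasure μ] {z : Ω → ℝ} {a : ℝ}
    (hz : AEStronglyMeasurable z μ) (hz0 : 0 ≤ z)
    (h : ∫⁻ x, ENNReal.ofReal (Real.exp (z x)) ∂μ ≤ ENNReal.ofReal (Real.exp a)) :
    Integrable z μ ∧ ∫ x, z x ∂μ ≤ a := by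
  have hexp : Integrable (fun x => Real.exp (z x)) μ := by
    refine (lintegral_ofReal_ne_top_iff_integrable
      (Real.continuous_exp.comp_aestronglyMeasurable hz) (ae_of_all _ fun x => (Real.exp_pos _).le)).1 ?_
    exact ne_top_of_le_ne_top (by simp) h
  have hint : Integrable z μ := hexp.mono' hz (ae_of_all _ fun x => by
    rw [Real.norm_of_nonneg (hz0 x)]
    linarith [Real.add_one_le_exp (z x)])
  refine ⟨hint, ?_⟩
  rw [← ofReal_integral_eq_lintegral_ofReal hexp (ae_of_all _ fun x => (Real.exp_pos _).le),
    ENNReal.ofReal_le_ofReal_iff (Real.exp_pos _).le] at h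
  have h1 : ∫ x, Real.exp a * (z x + (1 - a)) ∂μ ≤ ∫ x, Real.exp (z x) ∂μ := by
    refine integral_mono ((hint.add (integrable_const _)).const_mul _) hexp fun x => ?_
    have : Real.exp (z x) = Real.exp a * Real.exp (z x - a) := by rw [← Real.exp_add]; ring_nf
    simp only [this]
    gcongr
    linarith [Real.add_one_le_exp (z x - a)]
  rw [integral_const_mul, integral_add hint (integrable_const _)] at h1
  simp only [integral_const, probReal_univ, one_smul] at h1
  have := le_of_mul_le_mul_left (h1.trans (h.trans_eq (mul_one (Real.exp a)).symm)) (Real.exp_pos _)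
  linarith

/-- Jensen for the concave power `1 / (2a)`: a bound `exp a` becomes `exp (1/2) ≤ 2` once the
exponent is divided by `2a`. The inequality `key` is the pointwise form, convexity of `exp` between
`0` and `z - a`. -/
lemma psi2Norm_le_mul_sqrt [IsProbabilityMeasure μ] {s a : ℝ} (hs : 0 < s) (ha : 1 ≤ a)
    (h : ∫⁻ x, ENNReal.ofReal (Real.exp (f x ^ 2 / s ^ 2)) ∂μ ≤ ENNReal.ofReal (Real.exp a)) :
    psi2Norm f μ ≤ ENNReal.ofReal (s * √(2 * a)) := by
  refine psi2Norm_le_ofReal (by positivity) ?_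
  have hexp : Real.exp (1 / 2) ≤ 2 := by
    have h1 : Real.exp (1 / 2) ^ 2 = Real.exp 1 := by rw [← Real.exp_nat_mul]; norm_num
    nlinarith [Real.exp_one_lt_d9, Real.exp_pos (1 / 2)]
  have key : ∀ z : ℝ, Real.exp (z / (2 * a)) ≤
      Real.exp (1 / 2) * (1 - 1 / (2 * a)) + Real.exp (1 / 2) * (1 / (2 * a)) *
        Real.exp (-a) * Real.exp z := by
    intro z
    have hc := convexOn_exp.2 (Set.mem_univ 0) (Set.mem_univ (z - a))
      (show 0 ≤ 1 - 1 / (2 * a) by rw [sub_nonneg, div_le_one (by positivity)]; linarith)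
      (show 0 ≤ 1 / (2 * a) by positivity) (by ring)
    simp only [smul_eq_mul, mul_zero, zero_add, Real.exp_zero, mul_one] at hc
    calc Real.exp (z / (2 * a)) = Real.exp (1 / 2) * Real.exp (1 / (2 * a) * (z - a)) := by
          rw [← Real.exp_add]; congr 1; field_simp; ring
      _ ≤ Real.exp (1 / 2) * (1 - 1 / (2 * a) + 1 / (2 * a) * Real.exp (z - a)) := by gcongr
      _ = _ := by rw [sub_eq_neg_add z a, Real.exp_add]; ring
  have h0 : 0 ≤ 1 - 1 / (2 * a) := by
    rw [sub_nonneg, div_le_one (by positivity)]; linarith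
  calc ∫⁻ x, ENNReal.ofReal (Real.exp (f x ^ 2 / (s * √(2 * a)) ^ 2)) ∂μ
      ≤ ∫⁻ x, (ENNReal.ofReal (Real.exp (1 / 2) * (1 - 1 / (2 * a))) +
          ENNReal.ofReal (Real.exp (1 / 2) * (1 / (2 * a)) * Real.exp (-a)) *
            ENNReal.ofReal (Real.exp (f x ^ 2 / s ^ 2))) ∂μ := by
        refine lintegral_mono fun x => ?_
        rw [← ENNReal.ofReal_mul (by positivity), ← ENNReal.ofReal_add (by positivity) (by positivity)]
        refine ENNReal.ofReal_le_ofReal ?_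
        rw [mul_pow, Real.sq_sqrt (by positivity), ← div_div]
        exact key _
    _ = ENNReal.ofReal (Real.exp (1 / 2) * (1 - 1 / (2 * a))) +
          ENNReal.ofReal (Real.exp (1 / 2) * (1 / (2 * a)) * Real.exp (-a)) *
            ∫⁻ x, ENNReal.ofReal (Real.exp (f x ^ 2 / s ^ 2)) ∂μ := by
        rw [lintegral_add_left measurable_const, lintegral_const_mul' _ _ (by simp)]; simp
    _ ≤ ENNReal.ofReal (Real.exp (1 / 2) * (1 - 1 / (2 * a))) +
          ENNReal.ofReal (Real.exp (1 / 2) * (1 / (2 * a)) * Real.exp (-a)) *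
            ENNReal.ofReal (Real.exp a) := by gcongr
    _ = ENNReal.ofReal (Real.exp (1 / 2)) := by
        rw [← ENNReal.ofReal_mul (by positivity), ← ENNReal.ofReal_add (by positivity) (by positivity),
          mul_assoc, ← Real.exp_add]
        congr 1
        simp only [neg_add_cancel, Real.exp_zero]
        ring
    _ ≤ 2 := by
        rw [← ENNReal.ofReal_ofNat]
        exact ENNReal.ofReal_le_ofReal hexp

lemma sq_integral_le_integral_sq [IsProbabilityMeasure μ] (hf : Integrable f μ)
    (hf2 : Integrable (fun x => f x ^ 2) μ) : (∫ x, f x ∂μ) ^ 2 ≤ ∫ x, f x ^ 2 ∂μ := by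
  set b := ∫ x, f x ∂μ
  have h : 0 ≤ ∫ x, (f x ^ 2 - 2 * b * f x + b ^ 2) ∂μ := integral_nonneg fun x => by
    change 0 ≤ f x ^ 2 - 2 * b * f x + b ^ 2
    nlinarith [sq_nonneg (f x - b)]
  have hI : Integrable (fun x => f x ^ 2 - 2 * b * f x) μ := hf2.sub (hf.const_mul _)
  rw [integral_add hI (integrable_const _), integral_sub hf2 (hf.const_mul _),
    integral_const_mul] at h
  simp only [integral_const, probReal_univ, one_smul] at h
  change 0 ≤ _ - 2 * b * b + b ^ 2 at h
  linarith

lemma integrable_sq_of_lintegral_exp_le [IsProbabilityMeasure μ] {s a : ℝ} (hs : 0 < s)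
    (hf : AEStronglyMeasurable f μ)
    (h : ∫⁻ x, ENNReal.ofReal (Real.exp (f x ^ 2 / s ^ 2)) ∂μ ≤ ENNReal.ofReal (Real.exp a)) :
    Integrable (fun x => f x ^ 2) μ ∧ ∫ x, f x ^ 2 ∂μ ≤ s ^ 2 * a := by
  obtain ⟨h1, h2⟩ := integral_le_of_lintegral_exp_le (z := fun x => f x ^ 2 / s ^ 2)
    (by simpa [div_eq_mul_inv] using (hf.pow 2).mul_const _) (fun x => by positivity) h
  rw [integral_div, div_le_iff₀ (by positivity)] at h2
  refine ⟨?_, by linarith⟩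
  have := h1.mul_const (s ^ 2)
  simpa [div_mul_cancel₀ _ (pow_pos hs 2).ne'] using this

lemma integrable_of_integrable_sq [IsProbabilityMeasure μ]
    (hf : AEStronglyMeasurable f μ) (h : Integrable (fun x => f x ^ 2) μ) : Integrable f μ :=
  ((memLp_two_iff_integrable_sq hf).2 h).integrable (by norm_num)

/-- Exponential square integrability passes to the centred variable. -/
lemma psi2Norm_sub_integral_le [IsProbabilityMeasure μ] {s a : ℝ} (hs : 0 < s) (ha : 1 ≤ a)
    (hf : AEStronglyMeasurable f μ)
    (h : ∫⁻ x, ENNReal.ofReal (Real.exp (f x ^ 2 / s ^ 2)) ∂μ ≤ ENNReal.ofReal (Real.exp a)) :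
    psi2Norm (fun x => f x - ∫ y, f y ∂μ) μ ≤ ENNReal.ofReal (s * √(8 * a)) := by
  obtain ⟨h1, h2⟩ := integrable_sq_of_lintegral_exp_le hs hf h
  have h3 := sq_integral_le_integral_sq (integrable_of_integrable_sq hf h1) h1
  set b := ∫ y, f y ∂μ
  have hb : b ^ 2 / s ^ 2 ≤ a := by
    rw [div_le_iff₀ (by positivity)]; linarith
  -- The scale `√2 * s` absorbs the factor in `(f - b)² ≤ 2f² + 2b²`, and `b²/s² ≤ a` turns the
  -- bound `exp a` into `exp (2a)`.
  have := psi2Norm_le_mul_sqrt (f := fun x => f x - b) (μ := μ) (s := √2 * s) (a := 2 * a)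
    (by positivity) (by linarith) ?_
  · refine this.trans_eq ?_
    congr 1
    have : (8 : ℝ) * a = 2 * (2 * (2 * a)) := by ring
    rw [this, Real.sqrt_mul (by norm_num) (2 * (2 * a))]
    ring
  · calc ∫⁻ x, ENNReal.ofReal (Real.exp ((f x - b) ^ 2 / (√2 * s) ^ 2)) ∂μ
        ≤ ∫⁻ x, ENNReal.ofReal (Real.exp a) * ENNReal.ofReal (Real.exp (f x ^ 2 / s ^ 2)) ∂μ := by
          refine lintegral_mono fun x => ?_
          rw [← ENNReal.ofReal_mul (by positivity), ← Real.exp_add]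
          refine ENNReal.ofReal_le_ofReal (Real.exp_le_exp.2 ?_)
          rw [mul_pow, Real.sq_sqrt (by norm_num)]
          refine le_trans ?_ (add_le_add_left hb _)
          rw [← add_div, div_le_div_iff₀ (by positivity) (by positivity)]
          have : 0 ≤ (f x + b) ^ 2 * s ^ 2 := by positivity
          nlinarith
      _ ≤ ENNReal.ofReal (Real.exp a) * ENNReal.ofReal (Real.exp a) := by
          rw [lintegral_const_mul' _ _ (by simp)]
          gcongr
      _ = _ := by
          rw [← ENNReal.ofReal_mul (by positivity), ← Real.exp_add]; ring_nf

end Psi2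

/-! ### Covariance versus sub-Gaussian constant, and stability under Gaussian tilts -/

section Euclidean

variable {n : ℕ} {μ : Measure (EuclideanSpace ℝ (Fin n))}

lemma covarianceBilin_self_le [IsProbabilityMeasure μ] (hL : MemLp id 2 μ)
    {r : ℝ} (hr : sigmaSG μ < ENNReal.ofReal r) (θ : EuclideanSpace ℝ (Fin n)) (hθ : ‖θ‖ = 1) :
    covarianceBilin μ θ θ ≤ r ^ 2 := by
  have hr0 : 0 < r := by
    by_contra! h
    simp [ENNReal.ofReal_of_nonpos h] at hr
  have h1 : psi2Norm (fun x => inner ℝ (x - ∫ y, y ∂μ) θ) μ < ENNReal.ofReal r :=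
    lt_of_le_of_lt (le_iSup₂_of_le θ (by simpa using hθ) le_rfl) hr
  have h2 := lintegral_exp_sq_div_le_two h1
  have h3 := (integrable_sq_of_lintegral_exp_le (a := 1) hr0 (by fun_prop) (h2.trans (by
    rw [← ENNReal.ofReal_ofNat]
    exact ENNReal.ofReal_le_ofReal (by linarith [Real.exp_one_gt_d9])))).2
  rw [covarianceBilin_apply hL]
  simp only [id, ← sq]
  simpa [real_inner_comm] using h3

lemma covOpNorm_le_sigmaSG_sq [IsProbabilityMeasure μ] : covOpNorm μ ≤ sigmaSG μ ^ 2 := by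
  by_cases hL : MemLp id 2 μ
  swap
  · have h0 : ‖covarianceBilin μ‖ ≤ 0 :=
      ContinuousLinearMap.opNorm_le_bound₂ _ le_rfl fun u v => by
        rw [covarianceBilin_of_not_memLp hL]; simp
    rw [covOpNorm, ← ofReal_norm, ENNReal.ofReal_of_nonpos h0]
    exact zero_le
  by_cases hσ : sigmaSG μ = ⊤
  · simp [hσ]
  have key : ∀ r : ℝ, sigmaSG μ < ENNReal.ofReal r → covOpNorm μ ≤ ENNReal.ofReal r ^ 2 := by
    intro r hr
    have hr0 : 0 < r := by
      by_contra! h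
      simp [ENNReal.ofReal_of_nonpos h] at hr
    have hle : ∀ θ, covarianceBilin μ θ θ ≤ r ^ 2 * ‖θ‖ ^ 2 := by
      intro θ
      by_cases hθ : θ = 0
      · simp [hθ]
      have := covarianceBilin_self_le hL hr (‖θ‖⁻¹ • θ) (by
        rw [norm_smul, norm_inv, norm_norm, inv_mul_cancel₀ (norm_ne_zero_iff.2 hθ)])
      have hn : 0 < ‖θ‖ := norm_pos_iff.2 hθ
      simp only [map_smul, smul_apply, smul_eq_mul] at this
      rw [← mul_assoc, ← sq, inv_pow, inv_mul_le_iff₀ (by positivity)] at this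
      linarith
    have : ‖covarianceBilin μ‖ ≤ r ^ 2 := by
      refine ContinuousLinearMap.opNorm_le_bound₂ _ (by positivity) fun u v => ?_
      -- Cauchy–Schwarz for a positive semidefinite form reduces its norm to the diagonal.
      have hcs : (covarianceBilin μ u v) ^ 2 ≤ covarianceBilin μ u u * covarianceBilin μ v v :=
        LinearMap.BilinForm.apply_sq_le_of_symm (covarianceBilin μ).toBilinForm
          (fun x => covarianceBilin_self_nonneg x) ⟨covarianceBilin_comm⟩ u v
      rw [Real.norm_eq_abs]
      refine abs_le_of_sq_le_sq (hcs.trans ?_) (by positivity)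
      calc _ ≤ (r ^ 2 * ‖u‖ ^ 2) * (r ^ 2 * ‖v‖ ^ 2) := by
            gcongr
            · exact covarianceBilin_self_nonneg v
            · exact hle u
            · exact hle v
        _ = _ := by ring
    rw [covOpNorm, ← ofReal_norm, ← ENNReal.ofReal_pow hr0.le]
    exact ENNReal.ofReal_le_ofReal this
  lift sigmaSG μ to NNReal using hσ with σ
  have h2 : covOpNorm μ ≠ ⊤ := by simp [covOpNorm]
  lift covOpNorm μ to NNReal using h2 with v
  have : ∀ r : ℝ, (σ : ℝ) < r → (v : ℝ) ≤ r ^ 2 := by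
    intro r hr
    have hr0 : 0 ≤ r := σ.2.trans hr.le
    have := key r (by rw [← ENNReal.ofReal_coe_nnreal]; exact (ENNReal.ofReal_lt_ofReal_iff_of_nonneg σ.2).2 hr)
    rw [← ENNReal.ofReal_pow hr0, ← ENNReal.ofReal_coe_nnreal] at this
    exact (ENNReal.ofReal_le_ofReal_iff (by positivity)).1 this
  have hlim : (v : ℝ) ≤ (σ : ℝ) ^ 2 := by
    have hc : Filter.Tendsto (fun r : ℝ => r ^ 2) (nhdsWithin (σ : ℝ) (Set.Ioi (σ : ℝ))) (nhds ((σ : ℝ) ^ 2)) :=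
      ((continuous_pow 2).tendsto _).mono_left nhdsWithin_le_nhds
    exact ge_of_tendsto hc (Filter.eventually_of_mem self_mem_nhdsWithin this)
  exact_mod_cast hlim

variable {ν : Measure (EuclideanSpace ℝ (Fin n))} [IsProbabilityMeasure ν] {t : ℝ}

lemma integrable_exp_neg_mul_norm_sq (ht : 0 ≤ t) :
    Integrable (fun x => Real.exp (-(t * ‖x‖ ^ 2))) ν := by
  refine Integrable.of_bound (C := 1) (by fun_prop) (ae_of_all _ fun x => ?_)
  rw [Real.norm_of_nonneg (Real.exp_pos _).le, Real.exp_le_one_iff]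
  have : 0 ≤ t * ‖x‖ ^ 2 := by positivity
  linarith

lemma isProbabilityMeasure_gaussianTilt (ht : 0 ≤ t) : IsProbabilityMeasure (gaussianTilt ν t) :=
  isProbabilityMeasure_tilted (integrable_exp_neg_mul_norm_sq ht)

lemma lintegral_gaussianTilt (F : EuclideanSpace ℝ (Fin n) → ℝ≥0∞) (ht : 0 ≤ t) :
    ∫⁻ x, F x ∂(gaussianTilt ν t) = (ENNReal.ofReal (∫ x, Real.exp (-(t * ‖x‖ ^ 2)) ∂ν))⁻¹ *
      ∫⁻ x, ENNReal.ofReal (Real.exp (-(t * ‖x‖ ^ 2))) * F x ∂ν := by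
  have hpos : 0 < ∫ x, Real.exp (-(t * ‖x‖ ^ 2)) ∂ν :=
    integral_exp_pos (integrable_exp_neg_mul_norm_sq ht)
  rw [gaussianTilt, lintegral_tilted, ← lintegral_const_mul' _ _ (by simp [hpos])]
  refine lintegral_congr fun x => ?_
  rw [ENNReal.ofReal_div_of_pos hpos, div_eq_mul_inv]
  ring

lemma memLp_gaussianTilt (ht : 0 ≤ t) (h : Integrable (fun x => ‖x‖ ^ 2) ν) :
    MemLp id 2 (gaussianTilt ν t) := by
  rw [memLp_two_iff_integrable_sq_norm (by fun_prop), gaussianTilt,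
    integrable_tilted_iff (integrable_exp_neg_mul_norm_sq ht)]
  refine h.mono (by fun_prop) (ae_of_all _ fun x => ?_)
  rw [norm_smul]
  refine mul_le_of_le_one_left (norm_nonneg _) ?_
  rw [Real.norm_of_nonneg (Real.exp_pos _).le, Real.exp_le_one_iff]
  have : 0 ≤ t * ‖x‖ ^ 2 := by positivity
  linarith

lemma psi2Norm_inner_sub_le [IsProbabilityMeasure μ] (hL : MemLp id 2 μ) {s a : ℝ} (hs : 0 < s)
    (ha : 1 ≤ a) (θ : EuclideanSpace ℝ (Fin n))
    (h : ∫⁻ x, ENNReal.ofReal (Real.exp (inner ℝ x θ ^ 2 / s ^ 2)) ∂μ ≤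
      ENNReal.ofReal (Real.exp a)) :
    psi2Norm (fun x => inner ℝ (x - ∫ y, y ∂μ) θ) μ ≤ ENNReal.ofReal (s * √(8 * a)) := by
  have h2 := psi2Norm_sub_integral_le hs ha (f := fun x => inner ℝ x θ) (by fun_prop) h
  have hi : Integrable (fun x => x) μ := hL.integrable (by norm_num)
  have : ∫ y, inner ℝ y θ ∂μ = inner ℝ (∫ y, y ∂μ) θ := by
    rw [real_inner_comm, ← integral_inner hi]
    simp_rw [real_inner_comm]
  simpa only [inner_sub_left, this] using h2

/-- Stability of the sub-Gaussian constant under Gaussian tilts of measures whose norm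
concentrates. -/
lemma sigmaSG_gaussianTilt_le (ht : 0 ≤ t) (hi : Integrable (fun x => ‖x‖ ^ 2) ν)
    (hn : ∫ x, ‖x‖ ^ 2 ∂ν = n) {s l : ℝ} (hs : 0 < s) (hl : 0 < l)
    (hsθ : ∀ θ : EuclideanSpace ℝ (Fin n), ‖θ‖ = 1 →
      ∫⁻ x, ENNReal.ofReal (Real.exp (inner ℝ x θ ^ 2 / s ^ 2)) ∂ν ≤ 2)
    (hlθ : ∫⁻ x, ENNReal.ofReal (Real.exp ((‖x‖ - ∫ y, ‖y‖ ∂ν) ^ 2 / l ^ 2)) ∂ν ≤ 2) :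
    sigmaSG (gaussianTilt ν t) ≤ ENNReal.ofReal (s * √(80 * (1 + t ^ 2 * n * l ^ 2))) := by
  have := isProbabilityMeasure_gaussianTilt (ν := ν) ht
  set R := ∫ y, ‖y‖ ∂ν
  set T := t ^ 2 * n * l ^ 2
  have hT : 0 ≤ T := by positivity
  have hiN : Integrable (fun x => ‖x‖) ν := integrable_of_integrable_sq (by fun_prop) hi
  have hR0 : 0 ≤ R := integral_nonneg fun x => norm_nonneg x
  have hvar : ∫ x, (‖x‖ - R) ^ 2 ∂ν = n - R ^ 2 := by
    have : (fun x : EuclideanSpace ℝ (Fin n) => (‖x‖ - R) ^ 2) =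
        fun x => (‖x‖ ^ 2 - 2 * R * ‖x‖) + R ^ 2 := by ext; ring
    have hI : Integrable (fun x : EuclideanSpace ℝ (Fin n) => ‖x‖ ^ 2 - 2 * R * ‖x‖) ν :=
      hi.sub (hiN.const_mul _)
    rw [this, integral_add hI (integrable_const _),
      integral_sub hi (hiN.const_mul _), integral_const_mul, hn]
    simp only [integral_const, probReal_univ, one_smul]
    change n - 2 * R * R + R ^ 2 = _
    ring
  have h2e : (2 : ℝ≥0∞) ≤ ENNReal.ofReal (Real.exp 1) := by
    rw [← ENNReal.ofReal_ofNat]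
    exact ENNReal.ofReal_le_ofReal (by linarith [Real.exp_one_gt_d9])
  have hv := (integrable_sq_of_lintegral_exp_le (a := 1) hl (by fun_prop) (hlθ.trans h2e)).2
  rw [hvar] at hv
  have hv0 : 0 ≤ (n : ℝ) - R ^ 2 := hvar ▸ integral_nonneg fun x => sq_nonneg _
  -- Here `n - R²` is the variance of `|x|`. It is at most `l²` and at most `n`, hence its square is
  -- at most `n * l²`.
  have htv : t * (n - R ^ 2) ≤ 1 + T := by
    have h1 : ((n : ℝ) - R ^ 2) ^ 2 ≤ n * l ^ 2 := by
      rw [sq]; gcongr <;> nlinarith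
    have h2 : (t * (n - R ^ 2)) ^ 2 ≤ T := by
      rw [mul_pow]
      calc _ ≤ t ^ 2 * (n * l ^ 2) := by gcongr
        _ = T := by ring
    nlinarith [sq_nonneg (t * (n - R ^ 2) - 1)]
  have hRT : 4 * t ^ 2 * R ^ 2 * l ^ 2 ≤ 4 * T := by
    have : R ^ 2 ≤ n := by linarith
    calc 4 * t ^ 2 * R ^ 2 * l ^ 2 ≤ 4 * t ^ 2 * n * l ^ 2 := by gcongr
      _ = _ := by ring
  -- Jensen, in tangent-line form at `|x|² = n`.
  have hZ : Real.exp (-(t * n)) ≤ ∫ x, Real.exp (-(t * ‖x‖ ^ 2)) ∂ν := by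
    have h1 : ∫ x, Real.exp (-(t * n)) * (1 + t * n - t * ‖x‖ ^ 2) ∂ν ≤
        ∫ x, Real.exp (-(t * ‖x‖ ^ 2)) ∂ν := by
      refine integral_mono (((integrable_const _).sub (hi.const_mul _)).const_mul _)
        (integrable_exp_neg_mul_norm_sq ht) fun x => ?_
      have : Real.exp (-(t * ‖x‖ ^ 2)) =
          Real.exp (-(t * n)) * Real.exp (t * n - t * ‖x‖ ^ 2) := by
        rw [← Real.exp_add]; ring_nf
      simp only [this]
      gcongr
      linarith [Real.add_one_le_exp (t * n - t * ‖x‖ ^ 2)]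
    rw [integral_const_mul, integral_sub (integrable_const _) (hi.const_mul _), integral_const_mul,
      hn] at h1
    simpa using h1
  refine iSup₂_le fun θ hθ => ?_
  have hθ : ‖θ‖ = 1 := by simpa using hθ
  have := psi2Norm_inner_sub_le (μ := gaussianTilt ν t) (memLp_gaussianTilt ht hi) (s := √2 * s)
    (a := 5 * (1 + T)) (by positivity) (by linarith) θ ?_
  · refine this.trans_eq ?_
    congr 1
    have : 80 * (1 + T) = 2 * (8 * (5 * (1 + T))) := by ring
    rw [this, Real.sqrt_mul (by norm_num) (8 * (5 * (1 + T)))]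
    ring
  rw [lintegral_gaussianTilt _ ht]
  -- Expand `|x|² = R² + 2Rξ + ξ²` and drop `exp (-tξ²) ≤ 1`. The inequality `2uv ≤ u² + v²`
  -- separates the linear functional from the factor `exp (-2tRξ)`, and completing the square gives
  -- `-4tRξ ≤ 4t²R²l² + ξ²/l²`.
  have hpt : ∀ x : EuclideanSpace ℝ (Fin n), Real.exp (-(t * ‖x‖ ^ 2)) *
      Real.exp (inner ℝ x θ ^ 2 / (√2 * s) ^ 2) ≤
      Real.exp (-(t * R ^ 2)) * (1 / 2) * Real.exp (inner ℝ x θ ^ 2 / s ^ 2) +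
      Real.exp (-(t * R ^ 2)) * (1 / 2) * Real.exp (4 * T) *
        Real.exp ((‖x‖ - R) ^ 2 / l ^ 2) := by
    intro x
    set ξ := ‖x‖ - R with hξ
    set Y := inner ℝ x θ ^ 2 / s ^ 2
    have hx : ‖x‖ = R + ξ := by rw [hξ]; ring
    have e1 : inner ℝ x θ ^ 2 / (√2 * s) ^ 2 = Y / 2 := by
      rw [mul_pow, Real.sq_sqrt (by norm_num)]; simp only [Y]; field_simp
    have h1 : -(4 * t * R * ξ) ≤ 4 * T + ξ ^ 2 / l ^ 2 := by
      have h2 : ξ ^ 2 / l ^ 2 = (ξ / l) ^ 2 := by rw [div_pow]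
      have h3 : ξ = ξ / l * l := by field_simp
      have h4 := sq_nonneg (ξ / l + 2 * t * R * l)
      have h5 : 4 * t * R * ξ = 2 * (ξ / l) * (2 * t * R * l) := by
        conv_lhs => rw [h3]
        ring
      rw [h2, h5]
      nlinarith
    have h2 : Real.exp (Y / 2) * Real.exp (-(2 * t * R * ξ)) ≤
        1 / 2 * Real.exp Y + 1 / 2 * Real.exp (-(4 * t * R * ξ)) := by
      have e1 : Real.exp Y = Real.exp (Y / 2) ^ 2 := by rw [← Real.exp_nat_mul]; congr 1; push_cast; ring
      have e2 : Real.exp (-(4 * t * R * ξ)) = Real.exp (-(2 * t * R * ξ)) ^ 2 := by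
        rw [← Real.exp_nat_mul]; congr 1; push_cast; ring
      rw [e1, e2]
      nlinarith [sq_nonneg (Real.exp (Y / 2) - Real.exp (-(2 * t * R * ξ)))]
    calc Real.exp (-(t * ‖x‖ ^ 2)) * Real.exp (inner ℝ x θ ^ 2 / (√2 * s) ^ 2)
        ≤ Real.exp (-(t * R ^ 2)) * (Real.exp (Y / 2) * Real.exp (-(2 * t * R * ξ))) := by
          rw [e1, ← Real.exp_add, ← Real.exp_add, ← Real.exp_add, Real.exp_le_exp, hx]
          have : 0 ≤ t * ξ ^ 2 := by positivity
          nlinarith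
      _ ≤ Real.exp (-(t * R ^ 2)) * (1 / 2 * Real.exp Y +
            1 / 2 * (Real.exp (4 * T) * Real.exp (ξ ^ 2 / l ^ 2))) := by
          gcongr
          refine h2.trans ?_
          gcongr
          rw [← Real.exp_add]
          exact Real.exp_le_exp.2 h1
      _ = _ := by ring
  have hnum : ∫⁻ x, ENNReal.ofReal (Real.exp (-(t * ‖x‖ ^ 2))) *
      ENNReal.ofReal (Real.exp (inner ℝ x θ ^ 2 / (√2 * s) ^ 2)) ∂ν ≤
      ENNReal.ofReal (Real.exp (-(t * R ^ 2)) * Real.exp (1 + 4 * T)) := by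
    calc _ ≤ ∫⁻ x, (ENNReal.ofReal (Real.exp (-(t * R ^ 2)) * (1 / 2)) *
          ENNReal.ofReal (Real.exp (inner ℝ x θ ^ 2 / s ^ 2)) +
          ENNReal.ofReal (Real.exp (-(t * R ^ 2)) * (1 / 2) * Real.exp (4 * T)) *
          ENNReal.ofReal (Real.exp ((‖x‖ - R) ^ 2 / l ^ 2))) ∂ν := by
          refine lintegral_mono fun x => ?_
          rw [← ENNReal.ofReal_mul (by positivity), ← ENNReal.ofReal_mul (by positivity),
            ← ENNReal.ofReal_mul (by positivity), ← ENNReal.ofReal_add (by positivity) (by positivity)]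
          exact ENNReal.ofReal_le_ofReal (hpt x)
      _ ≤ ENNReal.ofReal (Real.exp (-(t * R ^ 2)) * (1 / 2)) * 2 +
          ENNReal.ofReal (Real.exp (-(t * R ^ 2)) * (1 / 2) * Real.exp (4 * T)) * 2 := by
          rw [lintegral_add_left (by fun_prop), lintegral_const_mul' _ _ (by simp),
            lintegral_const_mul' _ _ (by simp)]
          gcongr
          exact hsθ θ hθ
      _ ≤ _ := by
          rw [← ENNReal.ofReal_ofNat, ← ENNReal.ofReal_mul (by positivity),
            ← ENNReal.ofReal_mul (by positivity), ← ENNReal.ofReal_add (by positivity) (by positivity)]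
          refine ENNReal.ofReal_le_ofReal ?_
          have h1 : 1 ≤ Real.exp (4 * T) := Real.one_le_exp (by positivity)
          have h2 := Real.exp_one_gt_d9
          rw [Real.exp_add]
          have h3 : 1 + Real.exp (4 * T) ≤ Real.exp 1 * Real.exp (4 * T) := by nlinarith
          calc _ = Real.exp (-(t * R ^ 2)) * (1 + Real.exp (4 * T)) := by ring
            _ ≤ _ := by gcongr
  calc _ ≤ (ENNReal.ofReal (Real.exp (-(t * n))))⁻¹ *
        ENNReal.ofReal (Real.exp (-(t * R ^ 2)) * Real.exp (1 + 4 * T)) := by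
        gcongr
    _ = ENNReal.ofReal (Real.exp (t * (n - R ^ 2) + (1 + 4 * T))) := by
        rw [← ENNReal.ofReal_inv_of_pos (Real.exp_pos _), ← Real.exp_neg, ← Real.exp_add,
          ← ENNReal.ofReal_mul (Real.exp_pos _).le, ← Real.exp_add]
        congr 2; ring
    _ ≤ _ := ENNReal.ofReal_le_ofReal (Real.exp_le_exp.2 (by linarith))

end Euclidean

/-! ### Tilted log-concave measures are sub-Gaussian at scale `1 / √t` -/

section LogConcave

variable {n : ℕ} {ν : Measure (EuclideanSpace ℝ (Fin n))} {t : ℝ}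

/-- Prékopa–Leindler needs a measurable density. A convex set has null frontier and a convex
function is continuous on the interior of its domain, so passing to the interior changes nothing
almost everywhere. -/
lemma IsLogConcave.exists_isOpen (h : IsLogConcave ν) :
    ∃ (D : Set (EuclideanSpace ℝ (Fin n))) (V : EuclideanSpace ℝ (Fin n) → ℝ),
      IsOpen D ∧ ConvexOn ℝ D V ∧
      Measurable (D.indicator fun x => ENNReal.ofReal (Real.exp (-V x))) ∧
      ν = volume.withDensity (D.indicator fun x => ENNReal.ofReal (Real.exp (-V x))) := by
  obtain ⟨D, V, hV, rfl⟩ := h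
  refine ⟨interior D, V, isOpen_interior, hV.subset interior_subset hV.1.interior, ?_, ?_⟩
  · have hc : ContinuousOn (fun x => ENNReal.ofReal (Real.exp (-V x))) (interior D) :=
      ENNReal.continuous_ofReal.comp_continuousOn
        (Real.continuous_exp.comp_continuousOn hV.continuousOn_interior.neg)
    classical
    rw [← Set.piecewise_eq_indicator]
    exact hc.measurable_piecewise continuousOn_const isOpen_interior.measurableSet
  · refine withDensity_congr_ae (indicator_ae_eq_of_ae_eq_set ?_)
    exact (interior_ae_eq_of_null_frontier (hV.1.addHaar_frontier volume)).symm

/-- The Prékopa–Leindler inequality for Gaussian tilts of log-concave measures. -/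
lemma IsLogConcave.lintegral_exp_mul_lintegral_exp_neg_le_one [IsProbabilityMeasure ν]
    (h : IsLogConcave ν) (ht : 0 ≤ t) {φ ψ : EuclideanSpace ℝ (Fin n) → ℝ} (hφ : Measurable φ)
    (hψ : Measurable ψ) (H : ∀ x y, φ x - ψ y ≤ t * ‖x - y‖ ^ 2 / 2) :
    (∫⁻ x, ENNReal.ofReal (Real.exp (φ x)) ∂(gaussianTilt ν t)) *
      ∫⁻ x, ENNReal.ofReal (Real.exp (-ψ x)) ∂(gaussianTilt ν t) ≤ 1 := by
  have hprob := isProbabilityMeasure_gaussianTilt (ν := ν) ht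
  obtain ⟨D, V, hD, hV, hm, hν⟩ := h.exists_isOpen
  set ρ := D.indicator fun x => ENNReal.ofReal (Real.exp (-V x)) with hρ
  set r : EuclideanSpace ℝ (Fin n) → ℝ≥0∞ :=
    fun x => ρ x * ENNReal.ofReal (Real.exp (-(t * ‖x‖ ^ 2)))
  have hr : Measurable r := hm.mul (by fun_prop)
  obtain ⟨c, hc⟩ : ∃ c : ℝ≥0∞, ∀ F : EuclideanSpace ℝ (Fin n) → ℝ≥0∞, Measurable F →
      ∫⁻ x, F x ∂(gaussianTilt ν t) = c * ∫⁻ x, r x * F x := by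
    refine ⟨(ENNReal.ofReal (∫ x, Real.exp (-(t * ‖x‖ ^ 2)) ∂ν))⁻¹, fun F hF => ?_⟩
    rw [lintegral_gaussianTilt _ ht]
    congr 1
    conv_lhs => rw [hν]
    rw [lintegral_withDensity_eq_lintegral_mul _ hm (by fun_prop)]
    simp only [Pi.mul_apply, r, mul_assoc]
  have h1 : 1 = c * ∫⁻ x, r x := by
    have := hc (fun _ => 1) measurable_const
    simpa using this
  rw [hc _ (by fun_prop), hc _ (by fun_prop)]
  have key := isPrekopaLeindler_euclideanSpace n (fun x => r x * ENNReal.ofReal (Real.exp (φ x)))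
    (fun x => r x * ENNReal.ofReal (Real.exp (-ψ x))) r (hr.mul (by fun_prop))
    (hr.mul (by fun_prop)) hr fun x y => ?_
  · calc _ = c * c * ((∫⁻ x, r x * ENNReal.ofReal (Real.exp (φ x))) *
          ∫⁻ x, r x * ENNReal.ofReal (Real.exp (-ψ x))) := by ring
      _ ≤ c * c * (∫⁻ x, r x) ^ 2 := by gcongr
      _ = (c * ∫⁻ x, r x) ^ 2 := by ring
      _ = 1 := by rw [← h1, one_pow]
  · by_cases hx : x ∈ D
    swap
    · simp [r, hρ, hx]
    by_cases hy : y ∈ D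
    swap
    · simp [r, hρ, hy]
    have hxy : midpoint ℝ x y ∈ D := hV.1.midpoint_mem hx hy
    have hVm : V (midpoint ℝ x y) ≤ (V x + V y) / 2 := by
      have := hV.2 hx hy (show (0 : ℝ) ≤ 1 / 2 by norm_num)
        (show (0 : ℝ) ≤ 1 / 2 by norm_num) (by norm_num)
      rw [midpoint_eq_smul_add, smul_add]
      simp only [smul_eq_mul, one_div] at this
      simp only [invOf_eq_inv]
      linarith
    -- The term `-|x-y|²/4`, doubled by the square in Prékopa–Leindler, is the gain that pays for `φ
    -- x - ψ y`.
    have hnorm : ‖midpoint ℝ x y‖ ^ 2 = (‖x‖ ^ 2 + ‖y‖ ^ 2) / 2 - ‖x - y‖ ^ 2 / 4 := by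
      have := parallelogram_law_with_norm ℝ x y
      rw [midpoint_eq_smul_add, norm_smul]
      simp only [invOf_eq_inv, norm_inv, Real.norm_ofNat]
      rw [mul_pow]
      nlinarith
    simp only [r, hρ, Set.indicator_of_mem hx, Set.indicator_of_mem hy, Set.indicator_of_mem hxy]
    rw [← ENNReal.ofReal_mul (by positivity), ← ENNReal.ofReal_mul (by positivity),
      ← ENNReal.ofReal_mul (by positivity), ← ENNReal.ofReal_mul (by positivity),
      ← ENNReal.ofReal_mul (by positivity), ← ENNReal.ofReal_mul (by positivity),
      ← ENNReal.ofReal_pow (by positivity)]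
    refine ENNReal.ofReal_le_ofReal ?_
    rw [← Real.exp_add, ← Real.exp_add, ← Real.exp_add, ← Real.exp_add, ← Real.exp_add,
      ← Real.exp_add, ← Real.exp_nat_mul, Real.exp_le_exp, hnorm]
    have := H x y
    push_cast
    nlinarith

lemma ofReal_exp_integral_le {Ω : Type*} [MeasurableSpace Ω] {μ : Measure Ω}
    [IsProbabilityMeasure μ] {z : Ω → ℝ} (hz : Integrable z μ) :
    ENNReal.ofReal (Real.exp (∫ x, z x ∂μ)) ≤ ∫⁻ x, ENNReal.ofReal (Real.exp (z x)) ∂μ := by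
  by_cases hT : ∫⁻ x, ENNReal.ofReal (Real.exp (z x)) ∂μ = ⊤
  · simp [hT]
  have hexp : Integrable (fun x => Real.exp (z x)) μ :=
    (lintegral_ofReal_ne_top_iff_integrable
      (Real.continuous_exp.comp_aestronglyMeasurable hz.1)
      (ae_of_all _ fun x => (Real.exp_pos _).le)).1 hT
  rw [← ofReal_integral_eq_lintegral_ofReal hexp (ae_of_all _ fun x => (Real.exp_pos _).le)]
  refine ENNReal.ofReal_le_ofReal ?_
  exact convexOn_exp.map_integral_le Real.continuous_exp.continuousOn isClosed_univ (by simp) hz hexp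

/-- The right side equals `2 + 4 sinh² (x/2)`, and `sinh u ≥ u` for `u ≥ 0`. -/
lemma two_add_sq_le_exp_add_exp_neg (x : ℝ) : 2 + x ^ 2 ≤ Real.exp x + Real.exp (-x) := by
  have key : ∀ y : ℝ, 0 ≤ y → 2 + y ^ 2 ≤ Real.exp y + Real.exp (-y) := by
    intro y hy
    have h1 : y / 2 ≤ Real.sinh (y / 2) := by
      have := Real.sinh_sub_id_strictMono.monotone (show 0 ≤ y / 2 by positivity)
      simp only [Real.sinh_zero, sub_zero] at this
      linarith
    have h2 : Real.exp y + Real.exp (-y) = 2 * Real.cosh (2 * (y / 2)) := by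
      rw [Real.cosh_eq]; ring_nf
    rw [h2, Real.cosh_two_mul, Real.cosh_sq]
    nlinarith
  rcases le_total 0 x with h | h
  · exact key x h
  · have := key (-x) (by linarith)
    rw [neg_sq, neg_neg] at this
    linarith

/-- Linear functionals have variance of order at most `1 / t` under the tilt by `exp (-t|x|²)`. -/
lemma IsLogConcave.integral_sq_inner_sub_le [IsProbabilityMeasure ν]
    (h : IsLogConcave ν) (ht : 0 < t) (hi : Integrable (fun x => ‖x‖ ^ 2) ν)
    {θ : EuclideanSpace ℝ (Fin n)} (hθ : ‖θ‖ = 1) :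
    2 * t * ∫ x, inner ℝ (x - ∫ y, y ∂(gaussianTilt ν t)) θ ^ 2 ∂(gaussianTilt ν t) ≤
      Real.exp 1 - 1 := by
  have hprob := isProbabilityMeasure_gaussianTilt (ν := ν) ht.le
  have hL := memLp_gaussianTilt ht.le hi
  set μ := gaussianTilt ν t
  set b := ∫ y, y ∂μ with hb
  have hid : Integrable (fun x => x) μ := hL.integrable (by norm_num)
  have hW2 : MemLp (fun x => inner ℝ (x - b) θ) 2 μ := by
    exact (hL.sub (memLp_const b)).inner_const θ
  have hWi : Integrable (fun x => inner ℝ (x - b) θ) μ := hW2.integrable (by norm_num)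
  have hW0 : ∫ x, inner ℝ (x - b) θ ∂μ = 0 := by
    simp_rw [real_inner_comm θ]
    have hs : Integrable (fun x => x - b) μ := hid.sub (integrable_const b)
    rw [integral_inner hs, integral_sub hid (integrable_const b)]
    simp [hb]
  have hWd : ∀ x y, inner ℝ (x - b) θ - inner ℝ (y - b) θ ≤ ‖x - y‖ := by
    intro x y
    rw [← inner_sub_left, sub_sub_sub_cancel_right]
    simpa [hθ] using real_inner_le_norm (x - y) θ
  set W : EuclideanSpace ℝ (Fin n) → ℝ := fun x => inner ℝ (x - b) θ
  have hWm : Measurable W := by fun_prop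
  -- With `l² = 2t`, `(l * d - 2)² ≥ 0` reads `l * d - 1 ≤ t * d² / 2`: this admits `φ = l * W` and
  -- `ψ = l * W + 1`.
  set l := √(2 * t)
  have hl : l ^ 2 = 2 * t := Real.sq_sqrt (by positivity)
  have hl0 : 0 < l := Real.sqrt_pos.2 (by positivity)
  have key := h.lintegral_exp_mul_lintegral_exp_neg_le_one ht.le (φ := fun x => l * W x)
    (ψ := fun x => l * W x + 1) (by fun_prop) (by fun_prop) fun x y => by
      have h1 := mul_le_mul_of_nonneg_left (hWd x y) hl0.le
      have h2 := sq_nonneg (l * ‖x - y‖ - 2)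
      simp only [W]
      nlinarith
  have hP1 := ofReal_exp_integral_le (hWi.const_mul l)
  have hQ1 := ofReal_exp_integral_le (hWi.const_mul (-l))
  rw [integral_const_mul, hW0, mul_zero, Real.exp_zero, ENNReal.ofReal_one] at hP1 hQ1
  have e : ∫⁻ x, ENNReal.ofReal (Real.exp (-(l * W x + 1))) ∂μ =
      ENNReal.ofReal (Real.exp (-1)) * ∫⁻ x, ENNReal.ofReal (Real.exp (-l * W x)) ∂μ := by
    rw [← lintegral_const_mul' _ _ (by simp)]
    refine lintegral_congr fun x => ?_
    rw [← ENNReal.ofReal_mul (Real.exp_pos _).le, ← Real.exp_add]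
    congr 2; ring
  rw [e] at key
  set P := ∫⁻ x, ENNReal.ofReal (Real.exp (l * W x)) ∂μ with hP
  set Q := ∫⁻ x, ENNReal.ofReal (Real.exp (-l * W x)) ∂μ with hQ
  have hPQ : P * Q ≤ ENNReal.ofReal (Real.exp 1) := by
    calc P * Q = ENNReal.ofReal (Real.exp 1) * (P * (ENNReal.ofReal (Real.exp (-1)) * Q)) := by
          have : ENNReal.ofReal (Real.exp 1) * ENNReal.ofReal (Real.exp (-1)) = 1 := by
            rw [← ENNReal.ofReal_mul (Real.exp_pos _).le, ← Real.exp_add]; simp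
          calc P * Q = 1 * (P * Q) := (one_mul _).symm
            _ = _ := by rw [← this]; ring
      _ ≤ ENNReal.ofReal (Real.exp 1) * 1 := by gcongr
      _ = _ := mul_one _
  have hPt : P ≠ ⊤ := ne_top_of_le_ne_top (by simp) ((le_mul_of_one_le_right' hQ1).trans hPQ)
  have hQt : Q ≠ ⊤ := ne_top_of_le_ne_top (by simp) ((le_mul_of_one_le_left' hP1).trans hPQ)
  have hPi : Integrable (fun x => Real.exp (l * W x)) μ :=
    (lintegral_ofReal_ne_top_iff_integrable (by fun_prop)
      (ae_of_all _ fun x => (Real.exp_pos _).le)).1 hPt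
  have hQi : Integrable (fun x => Real.exp (-l * W x)) μ :=
    (lintegral_ofReal_ne_top_iff_integrable (by fun_prop)
      (ae_of_all _ fun x => (Real.exp_pos _).le)).1 hQt
  rw [← ofReal_integral_eq_lintegral_ofReal hPi (ae_of_all _ fun x => (Real.exp_pos _).le)] at hP
  rw [← ofReal_integral_eq_lintegral_ofReal hQi (ae_of_all _ fun x => (Real.exp_pos _).le)] at hQ
  set p := ∫ x, Real.exp (l * W x) ∂μ
  set q := ∫ x, Real.exp (-l * W x) ∂μ
  have hp1 : 1 ≤ p := by rwa [hP, ENNReal.one_le_ofReal] at hP1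
  have hq1 : 1 ≤ q := by rwa [hQ, ENNReal.one_le_ofReal] at hQ1
  have hpq : p * q ≤ Real.exp 1 := by
    rw [hP, hQ, ← ENNReal.ofReal_mul (by linarith)] at hPQ
    exact (ENNReal.ofReal_le_ofReal_iff (Real.exp_pos _).le).1 hPQ
  have hsum : 2 + 2 * t * ∫ x, W x ^ 2 ∂μ ≤ p + q := by
    have hW2i : Integrable (fun x => W x ^ 2) μ := hW2.integrable_sq
    have : ∫ x, (2 + 2 * t * W x ^ 2) ∂μ ≤ ∫ x, (Real.exp (l * W x) + Real.exp (-l * W x)) ∂μ := by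
      refine integral_mono ((integrable_const _).add (hW2i.const_mul _)) (hPi.add hQi) fun x => ?_
      have := two_add_sq_le_exp_add_exp_neg (l * W x)
      rw [mul_pow, hl] at this
      simpa only [neg_mul] using this
    rw [integral_add (integrable_const _) (hW2i.const_mul _), integral_add hPi hQi,
      integral_const_mul] at this
    simp only [integral_const, probReal_univ, one_smul] at this
    exact this
  -- From `p, q ≥ 1` follows `p + q ≤ 1 + p * q ≤ 1 + e`.
  nlinarith [mul_nonneg (sub_nonneg.2 hp1) (sub_nonneg.2 hq1)]

/-- Tilting a log-concave measure by `exp (-t|x|²)` makes it sub-Gaussian at scale `1 / √t`. -/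
lemma IsLogConcave.sigmaSG_gaussianTilt_sq_le [IsProbabilityMeasure ν]
    (h : IsLogConcave ν) (ht : 0 ≤ t) (hi : Integrable (fun x => ‖x‖ ^ 2) ν) :
    sigmaSG (gaussianTilt ν t) ^ 2 ≤ 4 * (ENNReal.ofReal t)⁻¹ := by
  rcases ht.eq_or_lt with rfl | ht
  · simp
  have hprob := isProbabilityMeasure_gaussianTilt (ν := ν) ht.le
  have hL := memLp_gaussianTilt ht.le hi
  have hσ : sigmaSG (gaussianTilt ν t) ≤ ENNReal.ofReal (2 / √t) := by
    refine iSup₂_le fun θ hθ => ?_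
    have hθ : ‖θ‖ = 1 := by simpa using hθ
    have hvar := h.integral_sq_inner_sub_le ht hi hθ
    set μ := gaussianTilt ν t
    set b := ∫ y, y ∂μ with hb
    have hW2 : MemLp (fun x => inner ℝ (x - b) θ) 2 μ := (hL.sub (memLp_const b)).inner_const θ
    have hWd : ∀ x y, |inner ℝ (x - b) θ - inner ℝ (y - b) θ| ≤ ‖x - y‖ := by
      intro x y
      rw [← inner_sub_left, sub_sub_sub_cancel_right]
      simpa [hθ] using abs_real_inner_le_norm (x - y) θ
    set W : EuclideanSpace ℝ (Fin n) → ℝ := fun x => inner ℝ (x - b) θ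
    have hWm : Measurable W := by fun_prop
    refine psi2Norm_le_ofReal (by positivity) ?_
    -- The pair is admissible because `W x² ≤ 2 W y² + 2 (W x - W y)²`. The variance bound then
    -- keeps `∫ exp (-ψ)` above `1/2`, whence `∫ exp (t W² / 4) ≤ 2`.
    have key := h.lintegral_exp_mul_lintegral_exp_neg_le_one ht.le (φ := fun x => t / 4 * W x ^ 2)
      (ψ := fun x => t / 2 * W x ^ 2) (by fun_prop) (by fun_prop) fun x y => by
        have h1 : (W x - W y) ^ 2 ≤ ‖x - y‖ ^ 2 := sq_le_sq.2 ((hWd x y).trans (le_abs_self _))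
        have h2 : W x ^ 2 ≤ 2 * W y ^ 2 + 2 * (W x - W y) ^ 2 := by
          nlinarith [sq_nonneg (W x - 2 * W y)]
        nlinarith
    have hQ := ofReal_exp_integral_le (hW2.integrable_sq.const_mul (-(t / 2)))
    rw [integral_const_mul] at hQ
    have hhalf : 1 / 2 ≤ Real.exp (-(t / 2) * ∫ x, W x ^ 2 ∂μ) := by
      have h1 := Real.add_one_le_exp (-(t / 2) * ∫ x, W x ^ 2 ∂μ)
      have h2 := Real.exp_one_lt_d9
      linarith
    have hQ2 : 2⁻¹ ≤ ∫⁻ x, ENNReal.ofReal (Real.exp (-(t / 2 * W x ^ 2))) ∂μ := by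
      simp only [← neg_mul]
      refine le_trans ?_ hQ
      refine le_trans (le_of_eq ?_) (ENNReal.ofReal_le_ofReal hhalf)
      rw [one_div, ENNReal.ofReal_inv_of_pos (by norm_num), ENNReal.ofReal_ofNat]
    have e : ∀ x, W x ^ 2 / (2 / √t) ^ 2 = t / 4 * W x ^ 2 := by
      intro x
      rw [div_pow, Real.sq_sqrt ht.le]
      field_simp
      ring
    change ∫⁻ x, ENNReal.ofReal (Real.exp (W x ^ 2 / (2 / √t) ^ 2)) ∂μ ≤ 2
    simp_rw [e]
    have := (mul_le_mul_right hQ2 _).trans key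
    rwa [← div_eq_mul_inv, ENNReal.div_le_iff (by simp) (by simp), one_mul] at this
  calc sigmaSG (gaussianTilt ν t) ^ 2 ≤ ENNReal.ofReal (2 / √t) ^ 2 := by gcongr
    _ = 4 * (ENNReal.ofReal t)⁻¹ := by
      rw [← ENNReal.ofReal_pow (by positivity), div_pow, Real.sq_sqrt ht.le,
        ENNReal.ofReal_div_of_pos ht, div_eq_mul_inv]
      norm_num

end LogConcave

/-! ### The upper bound -/

section UpperBound

variable {n : ℕ} {ν : Measure (EuclideanSpace ℝ (Fin n))} {t : ℝ}

lemma lintegral_exp_inner_le_two {μ : Measure (EuclideanSpace ℝ (Fin n))} {r : ℝ}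
    (hb : ∫ x, x ∂μ = 0) (hr : sigmaSG μ < ENNReal.ofReal r) {θ : EuclideanSpace ℝ (Fin n)}
    (hθ : ‖θ‖ = 1) :
    ∫⁻ x, ENNReal.ofReal (Real.exp (inner ℝ x θ ^ 2 / r ^ 2)) ∂μ ≤ 2 := by
  have h1 : psi2Norm (fun x => inner ℝ (x - ∫ y, y ∂μ) θ) μ < ENNReal.ofReal r :=
    lt_of_le_of_lt (le_iSup₂_of_le θ (by simpa using hθ) le_rfl) hr
  simpa only [hb, sub_zero] using lintegral_exp_sq_div_le_two h1

lemma integral_norm_sq_eq_sum [IsProbabilityMeasure ν] (hi : Integrable (fun x => ‖x‖ ^ 2) ν) :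
    ∫ x, ‖x‖ ^ 2 ∂ν = ∑ i, ∫ x, x i ^ 2 ∂ν := by
  rw [← integral_finsetSum]
  · simp_rw [EuclideanSpace.real_norm_sq_eq]
  · intro i _
    refine hi.mono (by fun_prop) (ae_of_all _ fun x => ?_)
    rw [EuclideanSpace.real_norm_sq_eq, Real.norm_of_nonneg (sq_nonneg _),
      Real.norm_of_nonneg (by positivity)]
    exact Finset.single_le_sum (f := fun i => x i ^ 2) (fun j _ => sq_nonneg _) (Finset.mem_univ i)

/-- Needed because `0 * ⊤ = 0` in `ℝ≥0∞`: a vanishing `sigmaSG` would make the bound trivialize to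
`0` when `normDeviation` is infinite. At scale `1/2` every coordinate would have second moment at
most `1/4`, contradicting the total `n`. -/
lemma sigmaSG_ne_zero [IsProbabilityMeasure ν] (hb : ∫ x, x ∂ν = 0) (hn : 1 ≤ n)
    (hi : Integrable (fun x => ‖x‖ ^ 2) ν) (h : ∫ x, ‖x‖ ^ 2 ∂ν = n) : sigmaSG ν ≠ 0 := by
  intro h0
  have key : ∀ i, ∫ x, x i ^ 2 ∂ν ≤ (1 / 2) ^ 2 * 1 := by
    intro i
    have h1 := lintegral_exp_inner_le_two (θ := EuclideanSpace.single i 1) (r := 1 / 2) hb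
      (by rw [h0]; simp) (by simp)
    simp only [EuclideanSpace.inner_single_right, conj_trivial, one_mul] at h1
    refine (integrable_sq_of_lintegral_exp_le (by norm_num) (by fun_prop) (h1.trans ?_)).2
    rw [← ENNReal.ofReal_ofNat]
    exact ENNReal.ofReal_le_ofReal (by linarith [Real.exp_one_gt_d9])
  rw [integral_norm_sq_eq_sum hi] at h
  have h2 : ∑ i, ∫ x, x i ^ 2 ∂ν ≤ ∑ i : Fin n, ((1 / 2) ^ 2 * 1 : ℝ) :=
    Finset.sum_le_sum fun i _ => key i
  rw [h] at h2
  simp only [Finset.sum_const, Finset.card_univ, Fintype.card_fin, nsmul_eq_mul] at h2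
  have : (1 : ℝ) ≤ n := by exact_mod_cast hn
  linarith

lemma gaussianTilt_zero [IsProbabilityMeasure ν] : gaussianTilt ν 0 = ν := by
  simp [gaussianTilt]

lemma sigmaSG_gaussianTilt_sq_le_mul [IsProbabilityMeasure ν] (hb : ∫ x, x ∂ν = 0) (hn : 1 ≤ n)
    (hi : Integrable (fun x => ‖x‖ ^ 2) ν) (h : ∫ x, ‖x‖ ^ 2 ∂ν = n) (ht : 0 ≤ t) :
    sigmaSG (gaussianTilt ν t) ^ 2 ≤ ENNReal.ofReal 960 *
      (sigmaSG ν ^ 2 * (1 + ENNReal.ofReal t ^ 2 * n * normDeviation ν ^ 2)) := by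
  have h960 : (1 : ℝ≥0∞) ≤ ENNReal.ofReal 960 := by
    rw [ENNReal.one_le_ofReal]; norm_num
  rcases ht.eq_or_lt with rfl | ht0
  · rw [gaussianTilt_zero]
    simpa using le_mul_of_one_le_left' h960
  have hσ0 := sigmaSG_ne_zero hb hn hi h
  have hn0 : (n : ℝ≥0∞) ≠ 0 := by simp; omega
  by_cases hσ : sigmaSG ν = ⊤
  · simp [hσ]
  by_cases hL : normDeviation ν = ⊤
  · simp [hL, ENNReal.mul_top, hn0, ht0, hσ0]
  obtain ⟨σ, hσe⟩ : ∃ σ : ℝ, sigmaSG ν = ENNReal.ofReal σ := ⟨_, (ENNReal.ofReal_toReal hσ).symm⟩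
  obtain ⟨L, hL0, hLe⟩ : ∃ L : ℝ, 0 ≤ L ∧ normDeviation ν = ENNReal.ofReal L :=
    ⟨_, ENNReal.toReal_nonneg, (ENNReal.ofReal_toReal hL).symm⟩
  have hσpos : 0 < σ := by
    by_contra! hc
    rw [ENNReal.ofReal_of_nonpos hc] at hσe
    exact hσ0 hσe
  -- The radius `L + ε` strictly exceeds the `Ψ₂` norm, while `t²nε² ≤ 1` keeps the loss to a
  -- constant factor.
  set ε := 1 / (1 + t * √n)
  have hε : 0 < ε := by positivity
  have hεt : t ^ 2 * n * ε ^ 2 ≤ 1 := by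
    have : t ^ 2 * n * ε ^ 2 = (t * √n / (1 + t * √n)) ^ 2 := by
      simp only [ε]
      rw [div_pow, div_pow, mul_pow, Real.sq_sqrt (by positivity)]
      ring
    rw [this]
    refine pow_le_one₀ (by positivity) ?_
    rw [div_le_one (by positivity)]
    linarith
  have key := sigmaSG_gaussianTilt_le ht hi h (s := 2 * σ) (l := L + ε) (by positivity)
    (by positivity) (fun θ hθ => lintegral_exp_inner_le_two hb
      (by rw [hσe]; exact (ENNReal.ofReal_lt_ofReal_iff (by positivity)).2 (by linarith)) hθ)
    (lintegral_exp_sq_div_le_two (f := fun x => ‖x‖ - ∫ y, ‖y‖ ∂ν) (by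
      change normDeviation ν < _
      rw [hLe]; exact (ENNReal.ofReal_lt_ofReal_iff (by positivity)).2 (by linarith)))
  calc sigmaSG (gaussianTilt ν t) ^ 2
      ≤ ENNReal.ofReal (2 * σ * √(80 * (1 + t ^ 2 * n * (L + ε) ^ 2))) ^ 2 := by gcongr
    _ = ENNReal.ofReal (320 * σ ^ 2 * (1 + t ^ 2 * n * (L + ε) ^ 2)) := by
      rw [← ENNReal.ofReal_pow (by positivity), mul_pow, Real.sq_sqrt (by positivity)]
      congr 1; ring
    _ ≤ ENNReal.ofReal (960 * (σ ^ 2 * (1 + t ^ 2 * n * L ^ 2))) := by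
      refine ENNReal.ofReal_le_ofReal ?_
      have : 1 + t ^ 2 * n * (L + ε) ^ 2 ≤ 3 * (1 + t ^ 2 * n * L ^ 2) := by
        have h1 : (L + ε) ^ 2 ≤ 2 * L ^ 2 + 2 * ε ^ 2 := by nlinarith [sq_nonneg (L - ε)]
        have h2 : t ^ 2 * n * (L + ε) ^ 2 ≤ t ^ 2 * n * (2 * L ^ 2 + 2 * ε ^ 2) := by gcongr
        have h3 : 0 ≤ t ^ 2 * n * L ^ 2 := by positivity
        nlinarith
      calc _ ≤ 320 * σ ^ 2 * (3 * (1 + t ^ 2 * n * L ^ 2)) := by gcongr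
        _ = _ := by ring
    _ = _ := by
      rw [ENNReal.ofReal_mul (by norm_num), ENNReal.ofReal_mul (by positivity),
        ENNReal.ofReal_add (by norm_num) (by positivity), ENNReal.ofReal_mul (by positivity),
        ENNReal.ofReal_mul (by positivity), ENNReal.ofReal_pow ht, ENNReal.ofReal_pow hL0,
        ENNReal.ofReal_pow hσpos.le, ENNReal.ofReal_one, ENNReal.ofReal_natCast, hσe, hLe]

theorem sigmaSG_gaussianTilt_sq_le_min [IsProbabilityMeasure ν] (hν : IsLogConcave ν)
    (hb : ∫ x, x ∂ν = 0) (h : ∫ x, ‖x‖ ^ 2 ∂ν = n) (ht : 0 ≤ t) :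
    sigmaSG (gaussianTilt ν t) ^ 2 ≤ ENNReal.ofReal 960 *
      min (sigmaSG ν ^ 2 * (1 + ENNReal.ofReal t ^ 2 * n * normDeviation ν ^ 2))
        (ENNReal.ofReal t)⁻¹ := by
  rcases Nat.eq_zero_or_pos n with rfl | hn
  · have : sigmaSG (gaussianTilt ν t) = 0 := by
      refine le_antisymm (iSup₂_le fun θ hθ => ?_) zero_le
      exact absurd (by simpa using hθ) (show ¬ ‖θ‖ = 1 by simp [Subsingleton.elim θ 0])
    simp [this]
  have hi : Integrable (fun x => ‖x‖ ^ 2) ν := by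
    by_contra hc
    rw [integral_undef hc] at h
    have : (n : ℝ) = 0 := h.symm
    norm_cast at this
    omega
  rw [mul_min]
  refine le_min (sigmaSG_gaussianTilt_sq_le_mul hb hn hi h ht)
    ((hν.sigmaSG_gaussianTilt_sq_le ht hi).trans ?_)
  gcongr
  rw [← ENNReal.ofReal_ofNat]
  exact ENNReal.ofReal_le_ofReal (by norm_num)

end UpperBound

/-! ### Truncated Gaussians on the cube and the fluctuation of `|y|²` -/

lemma lintegral_fin_prod_eq_prod {m : ℕ} {μ : Measure ℝ} [SigmaFinite μ]
    {f : Fin m → ℝ → ℝ≥0∞} (hf : ∀ i, Measurable (f i)) :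
    ∫⁻ y : Fin m → ℝ, ∏ i, f i (y i) ∂(Measure.pi fun _ => μ) = ∏ i, ∫⁻ x, f i x ∂μ := by
  induction m with
  | zero => simp
  | succ m ih =>
    have hm := (measurePreserving_piFinSuccAbove (fun _ : Fin (m + 1) => μ) 0).symm
    rw [← hm.lintegral_comp (by fun_prop)]
    simp only [MeasurableEquiv.piFinSuccAbove_symm_apply, Fin.prod_univ_succ,
      Fin.insertNthEquiv_zero, Fin.consEquiv_apply, Fin.cons_zero, Fin.cons_succ]
    rw [lintegral_prod_mul (f := f 0) (g := fun y : Fin m → ℝ => ∏ i, f i.succ (y i))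
      (hf 0).aemeasurable (Finset.measurable_fun_prod _ fun i _ =>
        (hf i.succ).comp (measurable_pi_apply i)).aemeasurable, ih (fun i => hf i.succ)]

lemma pi_withDensity {m : ℕ} {μ : Measure ℝ} [SigmaFinite μ] {f : ℝ → ℝ≥0∞} (hf : Measurable f)
    [SigmaFinite (μ.withDensity f)] :
    Measure.pi (fun _ : Fin m => μ.withDensity f) =
      (Measure.pi fun _ : Fin m => μ).withDensity fun y => ∏ i, f (y i) := by
  refine Measure.pi_eq fun s hs => ?_
  rw [withDensity_apply _ (MeasurableSet.univ_pi hs), ← lintegral_indicator (MeasurableSet.univ_pi hs)]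
  have : ∀ y : Fin m → ℝ, (Set.univ.pi s).indicator (fun y => ∏ i, f (y i)) y =
      ∏ i, (s i).indicator f (y i) := by
    intro y
    by_cases hy : y ∈ Set.univ.pi s
    · rw [Set.indicator_of_mem hy]
      exact Finset.prod_congr rfl fun i _ => by rw [Set.indicator_of_mem (hy i (Set.mem_univ i))]
    · rw [Set.indicator_of_notMem hy]
      simp only [Set.mem_pi, Set.mem_univ, forall_const, not_forall] at hy
      obtain ⟨i, hi⟩ := hy
      exact (Finset.prod_eq_zero (Finset.mem_univ i) (by rw [Set.indicator_of_notMem hi])).symm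
  simp_rw [this]
  rw [lintegral_fin_prod_eq_prod fun i => hf.indicator (hs i)]
  exact Finset.prod_congr rfl fun i _ => by
    rw [lintegral_indicator (hs i), withDensity_apply _ (hs i)]

/-- The probability measure on `[-1, 1]` with density proportional to `exp (-t y²)`. -/
noncomputable def truncatedGaussian (t : ℝ) : Measure ℝ :=
  (volume.restrict (Set.Icc (-1) 1)).tilted fun y => -(t * y ^ 2)

lemma integrable_exp_neg_mul_sq_Icc (t : ℝ) :
    Integrable (fun y : ℝ => Real.exp (-(t * y ^ 2))) (volume.restrict (Set.Icc (-1) 1)) :=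
  (Continuous.continuousOn (by fun_prop)).integrableOn_compact isCompact_Icc

instance (t : ℝ) : IsProbabilityMeasure (truncatedGaussian t) := by
  have : NeZero (volume.restrict (Set.Icc (-1 : ℝ) 1)) := ⟨by simp⟩
  exact isProbabilityMeasure_tilted (integrable_exp_neg_mul_sq_Icc t)

lemma truncatedGaussian_mem_Icc (t : ℝ) : ∀ᵐ y ∂(truncatedGaussian t), y ∈ Set.Icc (-1 : ℝ) 1 :=
  (tilted_absolutelyContinuous _ _) (ae_restrict_mem measurableSet_Icc)

lemma integral_exp_neg_mul_sq_Icc_pos (t : ℝ) :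
    0 < ∫ y in Set.Icc (-1 : ℝ) 1, Real.exp (-(t * y ^ 2)) := by
  have : NeZero (volume.restrict (Set.Icc (-1 : ℝ) 1)) := ⟨by simp⟩
  exact integral_exp_pos (integrable_exp_neg_mul_sq_Icc t)

/-- The constant is left unspecified: it depends only on `m` and `t`, and later cancels against the
normalization of a probability measure. -/
lemma exists_lintegral_cube_eq (m : ℕ) (t : ℝ) : ∃ c : ℝ≥0∞, ∀ G : (Fin m → ℝ) → ℝ≥0∞,
    Measurable G →
      ∫⁻ y in Set.univ.pi fun _ => Set.Icc (-1) 1,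
        ENNReal.ofReal (Real.exp (-(t * ∑ i, y i ^ 2))) * G y =
      c * ∫⁻ y, G y ∂(Measure.pi fun _ : Fin m => truncatedGaussian t) := by
  set Z := ∫ y in Set.Icc (-1 : ℝ) 1, Real.exp (-(t * y ^ 2)) with hZ
  have hZ0 : 0 < Z := integral_exp_neg_mul_sq_Icc_pos t
  refine ⟨ENNReal.ofReal Z ^ m, fun G hG => ?_⟩
  have hs : SigmaFinite ((volume.restrict (Set.Icc (-1 : ℝ) 1)).withDensity
      fun y => ENNReal.ofReal (Real.exp (-(t * y ^ 2)) / Z)) :=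
    inferInstanceAs (SigmaFinite (truncatedGaussian t))
  have h1 : Measure.pi (fun _ : Fin m => truncatedGaussian t) =
      (volume.restrict (Set.univ.pi fun _ => Set.Icc (-1) 1)).withDensity
        fun y => ∏ i, ENNReal.ofReal (Real.exp (-(t * y i ^ 2)) / Z) := by
    rw [volume_pi, Measure.restrict_pi_pi]
    exact pi_withDensity (by fun_prop)
  rw [h1, lintegral_withDensity_eq_lintegral_mul _ (by fun_prop) hG,
    ← lintegral_const_mul' _ _ (by finiteness)]
  refine lintegral_congr fun y => ?_
  simp only [Pi.mul_apply]
  rw [← mul_assoc]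
  congr 1
  have : ∀ i, ENNReal.ofReal (Real.exp (-(t * y i ^ 2)) / Z) =
      ENNReal.ofReal (Real.exp (-(t * y i ^ 2))) * (ENNReal.ofReal Z)⁻¹ := fun i => by
    rw [ENNReal.ofReal_div_of_pos hZ0, div_eq_mul_inv]
  simp_rw [this]
  rw [Finset.prod_mul_distrib, Finset.prod_const, Finset.card_univ, Fintype.card_fin,
    ← ENNReal.ofReal_prod_of_nonneg fun i _ => (Real.exp_pos _).le, ← Real.exp_sum,
    Finset.sum_neg_distrib, ← Finset.mul_sum, mul_left_comm, ← mul_pow,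
    ENNReal.mul_inv_cancel (by simp [hZ0]) (by simp), one_pow, mul_one]

/-- On `(-∞, 1]` the function `s ↦ exp (-ts)` decreases with slope at least `t * exp (-t)` in
absolute value. -/
lemma mul_exp_sub_exp_ge {t a b : ℝ} (ht : 0 ≤ t) (ha : a ≤ 1) (hb : b ≤ 1) :
    t * Real.exp (-t) * (a - b) ^ 2 ≤
      (a - b) * (Real.exp (-(t * b)) - Real.exp (-(t * a))) := by
  have key : ∀ a b : ℝ, a ≤ 1 → b ≤ a → t * Real.exp (-t) * (a - b) ^ 2 ≤
      (a - b) * (Real.exp (-(t * b)) - Real.exp (-(t * a))) := by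
    intro a b ha hba
    have h1 : Real.exp (-(t * b)) = Real.exp (-(t * a)) * Real.exp (t * (a - b)) := by
      rw [← Real.exp_add]; ring_nf
    have h2 := Real.add_one_le_exp (t * (a - b))
    have h3 : Real.exp (-t) ≤ Real.exp (-(t * a)) := Real.exp_le_exp.2 (by nlinarith)
    have h4 : 0 ≤ t * (a - b) := mul_nonneg ht (by linarith)
    have h5 : Real.exp (-t) * (t * (a - b)) ≤ Real.exp (-(t * b)) - Real.exp (-(t * a)) := by
      rw [h1]
      calc Real.exp (-t) * (t * (a - b)) ≤ Real.exp (-(t * a)) * (t * (a - b)) := by gcongr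
        _ ≤ Real.exp (-(t * a)) * (Real.exp (t * (a - b)) - 1) := by
          gcongr; linarith
        _ = _ := by ring
    calc _ = (a - b) * (Real.exp (-t) * (t * (a - b))) := by ring
      _ ≤ _ := by gcongr
  rcases le_total b a with h | h
  · exact key a b ha h
  · have := key b a hb h
    nlinarith

/-- Since `1/3 - y²` has mean zero on `[-1, 1]`, the weight may be replaced by its difference with
the value `exp (-t/3)`. That difference has the same sign as `1/3 - y²`, which leaves `t * exp (-t)
* ∫ (1/3 - y²)²`, with integral `8/45`; the normalization is at most `2`. -/
lemma integral_third_sub_sq_ge {t : ℝ} (ht : 0 ≤ t) :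
    t * Real.exp (-t) * (4 / 45) ≤ ∫ y, (1 / 3 - y ^ 2) ∂(truncatedGaussian t) := by
  rw [truncatedGaussian, integral_tilted]
  set Z := ∫ y in Set.Icc (-1 : ℝ) 1, Real.exp (-(t * y ^ 2)) with hZ
  have hZ0 : 0 < Z := integral_exp_neg_mul_sq_Icc_pos t
  have hi : ∀ f : ℝ → ℝ, Continuous f → Integrable f (volume.restrict (Set.Icc (-1) 1)) :=
    fun f hf => hf.continuousOn.integrableOn_compact isCompact_Icc
  have hpoly : ∀ f : ℝ → ℝ, ∫ y in Set.Icc (-1 : ℝ) 1, f y = ∫ y in (-1)..1, f y := fun f => by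
    rw [integral_Icc_eq_integral_Ioc, intervalIntegral.integral_of_le (by norm_num)]
  have hZ2 : Z ≤ 2 := by
    have : Z ≤ ∫ y in Set.Icc (-1 : ℝ) 1, (1 : ℝ) := by
      refine integral_mono (hi _ (by fun_prop)) (hi _ (by fun_prop)) fun y => ?_
      rw [Real.exp_le_one_iff]
      have : 0 ≤ t * y ^ 2 := by positivity
      linarith
    rw [hpoly] at this
    norm_num at this
    exact this
  have h0 : ∫ y in Set.Icc (-1 : ℝ) 1, (1 / 3 - y ^ 2) = 0 := by
    rw [hpoly, intervalIntegral.integral_sub (by simp) (by simp)]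
    norm_num
  have h2 : ∫ y in Set.Icc (-1 : ℝ) 1, (1 / 3 - y ^ 2) ^ 2 = 8 / 45 := by
    have : ∀ y : ℝ, (1 / 3 - y ^ 2) ^ 2 = 1 / 9 - 2 / 3 * y ^ 2 + y ^ 4 := fun y => by ring
    simp_rw [this]
    rw [hpoly, intervalIntegral.integral_add (by apply Continuous.intervalIntegrable; fun_prop) (by simp),
      intervalIntegral.integral_sub (by simp) (by apply Continuous.intervalIntegrable; fun_prop),
      intervalIntegral.integral_const_mul]
    norm_num
  have h1 : t * Real.exp (-t) * (8 / 45) ≤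
      ∫ y in Set.Icc (-1 : ℝ) 1, (1 / 3 - y ^ 2) * Real.exp (-(t * y ^ 2)) := by
    calc t * Real.exp (-t) * (8 / 45)
        = ∫ y in Set.Icc (-1 : ℝ) 1, t * Real.exp (-t) * (1 / 3 - y ^ 2) ^ 2 := by
          rw [integral_const_mul, h2]
      _ ≤ ∫ y in Set.Icc (-1 : ℝ) 1,
            ((1 / 3 - y ^ 2) * Real.exp (-(t * y ^ 2)) -
              Real.exp (-(t * (1 / 3))) * (1 / 3 - y ^ 2)) := by
          refine setIntegral_mono_on (hi _ (by fun_prop)) (hi _ (by fun_prop)) measurableSet_Icc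
            fun y hy => ?_
          have hy2 : y ^ 2 ≤ 1 := by
            rw [sq_le_one_iff_abs_le_one, abs_le]; exact hy
          refine (mul_exp_sub_exp_ge ht (show (1 / 3 : ℝ) ≤ 1 by norm_num) hy2).trans_eq ?_
          ring
      _ = _ := by
          rw [integral_sub (hi _ (by fun_prop)) (hi _ (by fun_prop)), integral_const_mul, h0]
          simp
  have e : ∀ y : ℝ, (Real.exp (-(t * y ^ 2)) / Z) • (1 / 3 - y ^ 2) =
      (1 / 3 - y ^ 2) * Real.exp (-(t * y ^ 2)) / Z := fun y => by
    rw [smul_eq_mul]; ring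
  simp_rw [e]
  rw [integral_div, le_div_iff₀ hZ0]
  have : 0 ≤ t * Real.exp (-t) * (4 / 45) := by positivity
  nlinarith

/-- Sub-Gaussian variables have exponentially integrable squares. -/
lemma ProbabilityTheory.HasSubgaussianMGF.lintegral_exp_sq_le {Ω : Type*} [MeasurableSpace Ω]
    {μ : Measure Ω} [IsProbabilityMeasure μ] {Z : Ω → ℝ} {c : NNReal} {r : ℝ}
    (h : HasSubgaussianMGF Z c μ) (hZ : Measurable Z) (hr : 0 < r) (hcr : c ≤ r) :
    ∫⁻ ω, ENNReal.ofReal (Real.exp (Z ω ^ 2 / (4 * r))) ∂μ ≤ 2 := by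
  -- Gaussian linearization: `exp (z²/(4r))` is the average of `exp (l * z)` over `l` of law `N(0,
  -- 1/(2r))`. Swapping integrals, the moment generating function bound leaves a Gaussian integral
  -- equal to `√2`.
  set v : NNReal := ⟨1 / (2 * r), by positivity⟩ with hv
  have hv0 : v ≠ 0 := by
    rw [← NNReal.coe_ne_zero]; change 1 / (2 * r) ≠ 0; positivity
  have hvr : (v : ℝ) = 1 / (2 * r) := rfl
  have h1 : ∀ z : ℝ, ENNReal.ofReal (Real.exp (z ^ 2 / (4 * r))) =
      ∫⁻ l, ENNReal.ofReal (Real.exp (l * z)) ∂(gaussianReal 0 v) := by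
    intro z
    have := mgf_gaussianReal (p := gaussianReal 0 v) (X := id) (μ := 0) (v := v) (by simp) z
    have hint := integrable_exp_mul_gaussianReal (μ := 0) (v := v) z
    simp only [mgf, id, mul_comm z] at this
    simp only [mul_comm z] at hint
    rw [← ofReal_integral_eq_lintegral_ofReal hint (ae_of_all _ fun x => (Real.exp_pos _).le), this,
      hvr]
    congr 2
    field_simp
    ring
  simp_rw [h1]
  rw [lintegral_lintegral_swap (by fun_prop)]
  calc ∫⁻ l, ∫⁻ ω, ENNReal.ofReal (Real.exp (l * Z ω)) ∂μ ∂(gaussianReal 0 v)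
      ≤ ∫⁻ l, ENNReal.ofReal (Real.exp (r * l ^ 2 / 2)) ∂(gaussianReal 0 v) := by
        refine lintegral_mono fun l => ?_
        rw [← ofReal_integral_eq_lintegral_ofReal (h.integrable_exp_mul l)
          (ae_of_all _ fun x => (Real.exp_pos _).le)]
        refine ENNReal.ofReal_le_ofReal ((h.mgf_le l).trans (Real.exp_le_exp.2 ?_))
        gcongr
    _ = ∫⁻ l, ENNReal.ofReal ((√(2 * Real.pi * v))⁻¹ * Real.exp (-(r / 2) * l ^ 2)) := by
        rw [gaussianReal_of_var_ne_zero _ hv0,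
          lintegral_withDensity_eq_lintegral_mul _ (by fun_prop) (by fun_prop)]
        refine lintegral_congr fun l => ?_
        simp only [Pi.mul_apply, gaussianPDF, gaussianPDFReal]
        rw [← ENNReal.ofReal_mul (by positivity), mul_assoc, ← Real.exp_add, hvr]
        congr 3
        field_simp
        ring
    _ = ENNReal.ofReal ((√(2 * Real.pi * v))⁻¹ * √(Real.pi / (r / 2))) := by
        rw [← ofReal_integral_eq_lintegral_ofReal
          ((integrable_exp_neg_mul_sq (by positivity)).const_mul _)
          (ae_of_all _ fun x => by positivity), integral_const_mul, integral_gaussian]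
    _ = ENNReal.ofReal √2 := by
        congr 1
        rw [← Real.sqrt_inv, ← Real.sqrt_mul (by positivity), hvr]
        congr 1
        field_simp
    _ ≤ 2 := by
        rw [← ENNReal.ofReal_ofNat]
        refine ENNReal.ofReal_le_ofReal ?_
        rw [Real.sqrt_le_left (by norm_num)]
        norm_num

/-- The normalised fluctuation of `|y|²` around its mean under the uniform measure on the cube. -/
noncomputable def cubeFluctuation (m : ℕ) (y : Fin m → ℝ) : ℝ :=
  ∑ i, (1 / 3 - y i ^ 2) / √(m + 1)

@[fun_prop]
lemma measurable_cubeFluctuation (m : ℕ) : Measurable (cubeFluctuation m) := by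
  unfold cubeFluctuation; fun_prop

section TruncatedGaussian

variable {m : ℕ} {t : ℝ}

/-- The product of `m` copies of the truncated Gaussian measure. -/
noncomputable abbrev truncatedGaussianPi (m : ℕ) (t : ℝ) : Measure (Fin m → ℝ) :=
  Measure.pi fun _ => truncatedGaussian t

lemma third_sub_sq_div_mem_Icc (m : ℕ) {y : ℝ} (hy : y ∈ Set.Icc (-1 : ℝ) 1) :
    (1 / 3 - y ^ 2) / √(m + 1) ∈ Set.Icc (-(2 / 3) / √((m : ℝ) + 1)) ((1 / 3) / √(m + 1)) := by
  have : y ^ 2 ≤ 1 := by rw [sq_le_one_iff_abs_le_one, abs_le]; exact hy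
  constructor <;> gcongr <;> nlinarith [sq_nonneg y]

lemma memLp_third_sub_sq_div (m : ℕ) (t : ℝ) :
    MemLp (fun y : ℝ => (1 / 3 - y ^ 2) / √(m + 1)) 2 (truncatedGaussian t) :=
  memLp_of_bounded ((truncatedGaussian_mem_Icc t).mono fun _ => third_sub_sq_div_mem_Icc m)
    (by fun_prop) 2

lemma integral_cubeFluctuation (m : ℕ) (t : ℝ) :
    ∫ y, cubeFluctuation m y ∂(truncatedGaussianPi m t) =
      m / √(m + 1) * ∫ y, (1 / 3 - y ^ 2) ∂(truncatedGaussian t) := by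
  have hi := (memLp_third_sub_sq_div m t).integrable (by norm_num)
  simp only [cubeFluctuation]
  rw [integral_finsetSum _ fun i _ => integrable_comp_eval
    (μ := fun _ : Fin m => truncatedGaussian t) (i := i) hi]
  simp_rw [fun i : Fin m => integral_comp_eval (μ := fun _ : Fin m => truncatedGaussian t) (i := i)
    hi.1, integral_div]
  simp only [Finset.sum_const, Finset.card_univ, Fintype.card_fin, nsmul_eq_mul]
  ring

lemma memLp_cubeFluctuation (m : ℕ) (t : ℝ) : MemLp (cubeFluctuation m) 2 (truncatedGaussianPi m t) :=
  memLp_finsetSum _ fun i _ => (memLp_third_sub_sq_div m t).comp_measurePreserving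
    (measurePreserving_eval (fun _ : Fin m => truncatedGaussian t) i)

lemma variance_cubeFluctuation_le (m : ℕ) (t : ℝ) : Var[cubeFluctuation m; truncatedGaussianPi m t] ≤ 1 := by
  have h1 := variance_sum_pi (μ := fun _ : Fin m => truncatedGaussian t)
    (X := fun _ y => (1 / 3 - y ^ 2) / √(m + 1)) fun _ => memLp_third_sub_sq_div m t
  have h2 : (∑ i : Fin m, fun y : Fin m → ℝ => (1 / 3 - y i ^ 2) / √((m : ℝ) + 1)) =
      cubeFluctuation m := by
    ext y; simp [cubeFluctuation]
  rw [h2] at h1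
  rw [h1]
  have h3 : Var[fun y => (1 / 3 - y ^ 2) / √((m : ℝ) + 1); truncatedGaussian t] ≤
      1 / (m + 1) := by
    refine (variance_le_sq_of_bounded ((truncatedGaussian_mem_Icc t).mono
      fun _ => third_sub_sq_div_mem_Icc m) (by fun_prop)).trans ?_
    rw [← sub_div, div_div, div_pow, mul_pow, Real.sq_sqrt (by positivity)]
    rw [div_le_div_iff₀ (by positivity) (by positivity)]
    have : (0 : ℝ) ≤ m := by positivity
    nlinarith
  calc _ ≤ ∑ i : Fin m, (1 / ((m : ℝ) + 1)) := Finset.sum_le_sum fun i _ => h3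
    _ ≤ 1 := by
      simp only [Finset.sum_const, Finset.card_univ, Fintype.card_fin, nsmul_eq_mul]
      rw [mul_one_div, div_le_one (by positivity)]
      linarith

/-- Chebyshev at distance `2` with variance at most `1`. The `3` is the `1` of the hypothesis plus
this distance. -/
lemma measure_cubeFluctuation_ge {W : ℝ} (hW : W ≤ 1 + ∫ y, cubeFluctuation m y ∂(truncatedGaussianPi m t)) :
    ENNReal.ofReal (3 / 4) ≤ (truncatedGaussianPi m t) {y | W ≤ 3 + cubeFluctuation m y} := by
  set μ := truncatedGaussianPi m t
  have h1 := meas_ge_le_variance_div_sq (memLp_cubeFluctuation m t) (c := 2) (by norm_num)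
  have h2 : μ {y | W ≤ 3 + cubeFluctuation m y}ᶜ ≤ ENNReal.ofReal (1 / 4) := by
    refine (measure_mono fun y hy => ?_).trans (h1.trans (ENNReal.ofReal_le_ofReal ?_))
    · simp only [Set.mem_compl_iff, Set.mem_ofPred_eq, not_le] at hy ⊢
      change W ≤ 1 + ∫ y, cubeFluctuation m y ∂μ at hW
      rw [abs_sub_comm]
      refine le_trans ?_ (le_abs_self _)
      linarith
    · have := variance_cubeFluctuation_le m t
      linarith
  rw [prob_compl_eq_one_sub (measurableSet_le measurable_const (by fun_prop)),
    tsub_le_iff_right] at h2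
  have h3 : (1 : ℝ≥0∞) = ENNReal.ofReal (1 / 4) + ENNReal.ofReal (3 / 4) := by
    rw [← ENNReal.ofReal_add (by norm_num) (by norm_num)]; norm_num
  rw [h3] at h2
  exact (ENNReal.add_le_add_iff_left (by simp)).1 h2

lemma integral_truncatedGaussian_zero (f : ℝ → ℝ) :
    ∫ y, f y ∂(truncatedGaussian 0) = (∫ y in (-1)..1, f y) / 2 := by
  rw [truncatedGaussian, integral_tilted]
  simp only [zero_mul, neg_zero, Real.exp_zero]
  rw [integral_smul, intervalIntegral.integral_of_le (by norm_num),
    ← integral_Icc_eq_integral_Ioc]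
  norm_num
  ring

lemma integral_cubeFluctuation_zero (m : ℕ) : ∫ y, cubeFluctuation m y ∂(truncatedGaussianPi m 0) = 0 := by
  rw [integral_cubeFluctuation, integral_truncatedGaussian_zero,
    intervalIntegral.integral_sub (by simp) (by simp)]
  norm_num

/-- Hoeffding: each summand is centred with range of length `1/√(m+1)`, so the variance proxies add
up to at most `1/4`. -/
lemma lintegral_exp_cubeFluctuation_sq_le (m : ℕ) :
    ∫⁻ y, ENNReal.ofReal (Real.exp (cubeFluctuation m y ^ 2)) ∂(truncatedGaussianPi m 0) ≤ 2 := by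
  have hsub : ∀ i : Fin m, HasSubgaussianMGF (fun y : Fin m → ℝ => (1 / 3 - y i ^ 2) / √((m : ℝ) + 1))
      ((‖(1 / 3) / √((m : ℝ) + 1) - -(2 / 3) / √((m : ℝ) + 1)‖₊ / 2) ^ 2) (truncatedGaussianPi m 0) := by
    intro i
    refine hasSubgaussianMGF_of_mem_Icc_of_integral_eq_zero
      (Measurable.aemeasurable (by fun_prop)) ?_ ?_
    · exact ((measurePreserving_eval (fun _ : Fin m => truncatedGaussian 0) i).quasiMeasurePreserving.ae
        (truncatedGaussian_mem_Icc 0)).mono fun y hy => third_sub_sq_div_mem_Icc m hy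
    · rw [integral_comp_eval (μ := fun _ : Fin m => truncatedGaussian 0) (i := i)
        (f := fun y => (1 / 3 - y ^ 2) / √((m : ℝ) + 1)) (by fun_prop), integral_div,
        integral_truncatedGaussian_zero, intervalIntegral.integral_sub (by simp) (by simp)]
      norm_num
  have hind : iIndepFun (fun (i : Fin m) (y : Fin m → ℝ) => (1 / 3 - y i ^ 2) / √((m : ℝ) + 1))
      (truncatedGaussianPi m 0) :=
    iIndepFun_pi (X := fun _ y => (1 / 3 - y ^ 2) / √((m : ℝ) + 1)) (fun i => by fun_prop)
  have h := (HasSubgaussianMGF.sum_of_iIndepFun hind (s := Finset.univ) fun i _ => hsub i).lintegral_exp_sq_le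
    (r := 1 / 4) (by fun_prop) (by norm_num) ?_
  · convert h using 5 with y
    simp [cubeFluctuation]
  · push_cast
    simp only [Finset.sum_const, Finset.card_univ, Fintype.card_fin, nsmul_eq_mul]
    rw [← sub_div, Real.norm_of_nonneg (by positivity), div_div, div_pow, mul_pow,
      Real.sq_sqrt (by positivity), mul_div_assoc', div_le_div_iff₀ (by positivity) (by positivity)]
    norm_num

/-- Hoeffding again, with proxy `a i ^ 2` for each summand. -/
lemma lintegral_exp_sum_mul_sq_le {a : Fin m → ℝ} (ha : ∑ i, a i ^ 2 ≤ 1) :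
    ∫⁻ y, ENNReal.ofReal (Real.exp ((∑ i, a i * y i) ^ 2 / 4)) ∂(truncatedGaussianPi m 0) ≤ 2 := by
  have hsub : ∀ i : Fin m, HasSubgaussianMGF (fun y : Fin m → ℝ => a i * y i)
      ((‖|a i| - -|a i|‖₊ / 2) ^ 2) (truncatedGaussianPi m 0) := by
    intro i
    refine hasSubgaussianMGF_of_mem_Icc_of_integral_eq_zero
      (Measurable.aemeasurable (by fun_prop)) ?_ ?_
    · refine ((measurePreserving_eval (fun _ : Fin m => truncatedGaussian 0) i).quasiMeasurePreserving.ae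
        (truncatedGaussian_mem_Icc 0)).mono fun y hy => ?_
      rw [Set.mem_Icc, ← abs_le, abs_mul]
      exact mul_le_of_le_one_right (abs_nonneg _) (abs_le.2 hy)
    · rw [integral_comp_eval (μ := fun _ : Fin m => truncatedGaussian 0) (i := i)
        (f := fun y => a i * y) (by fun_prop), integral_const_mul,
        integral_truncatedGaussian_zero]
      norm_num
  have hind : iIndepFun (fun (i : Fin m) (y : Fin m → ℝ) => a i * y i) (truncatedGaussianPi m 0) :=
    iIndepFun_pi (X := fun i y => a i * y) (fun i => by fun_prop)
  have h := (HasSubgaussianMGF.sum_of_iIndepFun hind (s := Finset.univ) fun i _ => hsub i).lintegral_exp_sq_le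
    (r := 1) (by fun_prop) (by norm_num) ?_
  · simpa using h
  · push_cast
    refine le_trans (le_of_eq (Finset.sum_congr rfl fun i _ => ?_)) ha
    rw [sub_neg_eq_add, Real.norm_of_nonneg (by positivity), ← two_mul,
      mul_div_cancel_left₀ _ (by norm_num), sq_abs]

end TruncatedGaussian

/-! ### Uniform measures on convex bodies -/

section UniformMeasure

variable {n : ℕ} {K : Set (EuclideanSpace ℝ (Fin n))}

lemma isProbabilityMeasure_cond_volume (hK : IsCompact K) (hi : (interior K).Nonempty) :
    IsProbabilityMeasure (cond volume K) :=
  cond_isProbabilityMeasure_of_finite (Measure.measure_pos_of_nonempty_interior _ hi).ne'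
    hK.measure_ne_top

lemma isLogConcave_cond_volume (hc : Convex ℝ K) (hK : IsCompact K) (hi : (interior K).Nonempty) :
    IsLogConcave (cond volume K) := by
  have h0 : volume K ≠ 0 := (Measure.measure_pos_of_nonempty_interior _ hi).ne'
  have hpos : 0 < (volume K).toReal := ENNReal.toReal_pos h0 hK.measure_ne_top
  refine ⟨K, fun _ => Real.log (volume K).toReal, convexOn_const _ hc, ?_⟩
  rw [withDensity_indicator hK.measurableSet, withDensity_const, Real.exp_neg, Real.exp_log hpos,
    ENNReal.ofReal_inv_of_pos hpos, ENNReal.ofReal_toReal hK.measure_ne_top]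
  rfl

lemma cond_volume_smul (hK : MeasurableSet K) {a : ℝ} (ha : 0 < a) :
    cond volume (a • K) = (cond volume K).map fun x => a • x := by
  ext s hs
  have hm : Measurable fun x : EuclideanSpace ℝ (Fin n) => a • x := by fun_prop
  rw [Measure.map_apply hm hs, cond_apply hK, cond_apply (hK.const_smul₀ a)]
  have : a • K ∩ s = a • (K ∩ (fun x => a • x) ⁻¹' s) := by
    ext x
    simp only [Set.mem_inter_iff, Set.mem_smul_set, Set.mem_preimage]
    constructor
    · rintro ⟨⟨y, hy, rfl⟩, hs⟩
      exact ⟨y, ⟨hy, hs⟩, rfl⟩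
    · rintro ⟨y, ⟨hy, hs⟩, rfl⟩
      exact ⟨⟨y, hy, rfl⟩, hs⟩
  rw [this, Measure.addHaar_smul, Measure.addHaar_smul]
  have hne : ENNReal.ofReal |a ^ Module.finrank ℝ (EuclideanSpace ℝ (Fin n))| ≠ 0 := by
    simp only [ne_eq, ENNReal.ofReal_eq_zero, not_le]
    positivity
  rw [ENNReal.mul_inv (Or.inl hne) (Or.inl (by simp)), mul_mul_mul_comm,
    ENNReal.inv_mul_cancel hne (by simp), one_mul]

end UniformMeasure

/-! ### The convex body over the cube and its disintegration -/

section ConeBody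

/-- An unconditional convex body: over the point `y` of the cube `[-1, 1]^m` it has the
interval of half-width `3 + ∑ (1/3 - y_i²) / √(m + 1)`. -/
def coneBody (m : ℕ) : Set (EuclideanSpace ℝ (Fin (m + 1))) :=
  {x | (∀ i : Fin m, |x i.succ| ≤ 1) ∧ |x 0| ≤ 3 + cubeFluctuation m fun i => x i.succ}

variable (m : ℕ)

lemma concaveOn_cubeFluctuation : ConcaveOn ℝ Set.univ (cubeFluctuation m) := by
  refine ⟨convex_univ, fun x _ y _ a b ha hb hab => ?_⟩
  simp only [cubeFluctuation, smul_eq_mul, Finset.mul_sum, ← Finset.sum_add_distrib, Pi.add_apply,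
    Pi.smul_apply]
  refine Finset.sum_le_sum fun i _ => ?_
  rw [← mul_div_assoc, ← mul_div_assoc, ← add_div]
  gcongr
  have : b = 1 - a := by linarith
  subst this
  nlinarith [mul_nonneg (mul_nonneg ha hb) (sq_nonneg (x i - y i))]

lemma convex_coneBody : Convex ℝ (coneBody m) := by
  intro x hx y hy a b ha hb hab
  have habs : ∀ u v : ℝ, |a * u + b * v| ≤ a * |u| + b * |v| := fun u v => by
    refine (abs_add_le _ _).trans ?_
    rw [abs_mul, abs_mul, abs_of_nonneg ha, abs_of_nonneg hb]
  refine ⟨fun i => ?_, ?_⟩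
  · have := habs (x i.succ) (y i.succ)
    simp only [PiLp.add_apply, PiLp.smul_apply, smul_eq_mul]
    nlinarith [hx.1 i, hy.1 i]
  · have h1 := habs (x 0) (y 0)
    have h2 := (concaveOn_cubeFluctuation m).2 (Set.mem_univ fun i => x i.succ)
      (Set.mem_univ fun i => y i.succ) ha hb hab
    have h3 := mul_le_mul_of_nonneg_left hx.2 ha
    have h4 := mul_le_mul_of_nonneg_left hy.2 hb
    have e : (fun i : Fin m => (a • x + b • y) i.succ) =
        a • (fun i : Fin m => x i.succ) + b • fun i : Fin m => y i.succ := by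
      ext i; simp
    rw [e]
    simp only [PiLp.add_apply, PiLp.smul_apply, smul_eq_mul] at h2 ⊢
    have h5 : a * (3 + cubeFluctuation m fun i => x i.succ) +
        b * (3 + cubeFluctuation m fun i => y i.succ) = 3 * (a + b) +
          (a * (cubeFluctuation m fun i => x i.succ) + b * cubeFluctuation m fun i => y i.succ) := by
      ring
    rw [hab] at h5
    linarith

lemma continuous_cubeFluctuation : Continuous (cubeFluctuation m) := by
  unfold cubeFluctuation; fun_prop

lemma continuous_coneBody_height :
    Continuous fun x : EuclideanSpace ℝ (Fin (m + 1)) => 3 + cubeFluctuation m fun i => x i.succ :=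
  continuous_const.add ((continuous_cubeFluctuation m).comp (by fun_prop))

lemma isCompact_coneBody : IsCompact (coneBody m) := by
  refine Metric.isCompact_of_isClosed_isBounded ?_ ?_
  · have h1 : IsClosed {x : EuclideanSpace ℝ (Fin (m + 1)) | ∀ i : Fin m, |x i.succ| ≤ 1} := by
      simp only [Set.ofPred_forall]
      exact isClosed_iInter fun i => isClosed_le (by fun_prop) continuous_const
    exact h1.inter (isClosed_le (by fun_prop) (continuous_coneBody_height m))
  · refine (Metric.isBounded_iff_subset_closedBall 0).2 ⟨√((3 + m) ^ 2 + m), fun x hx => ?_⟩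
    rw [mem_closedBall_zero_iff, EuclideanSpace.norm_eq]
    refine Real.sqrt_le_sqrt ?_
    rw [Fin.sum_univ_succ]
    have h1 : (cubeFluctuation m fun i => x i.succ) ≤ m := by
      calc _ ≤ ∑ i : Fin m, (1 : ℝ) := by
            refine Finset.sum_le_sum fun i _ => ?_
            rw [div_le_one (by positivity)]
            have : 1 ≤ √((m : ℝ) + 1) := Real.one_le_sqrt.2 (by linarith [Nat.cast_nonneg (α := ℝ) m])
            nlinarith [sq_nonneg (x i.succ)]
        _ = m := by simp
    have h2 : ‖x 0‖ ≤ 3 + m := by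
      rw [Real.norm_eq_abs]; linarith [hx.2]
    have h3 : ∑ i : Fin m, ‖x i.succ‖ ^ 2 ≤ m := by
      calc _ ≤ ∑ i : Fin m, (1 : ℝ) := by
            refine Finset.sum_le_sum fun i _ => ?_
            rw [Real.norm_eq_abs]
            exact pow_le_one₀ (abs_nonneg _) (hx.1 i)
        _ = m := by simp
    gcongr

lemma interior_coneBody_nonempty : (interior (coneBody m)).Nonempty := by
  have hopen : IsOpen {x : EuclideanSpace ℝ (Fin (m + 1)) | (∀ i : Fin m, |x i.succ| < 1) ∧
      |x 0| < 3 + cubeFluctuation m fun i => x i.succ} := by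
    have h1 : IsOpen {x : EuclideanSpace ℝ (Fin (m + 1)) | ∀ i : Fin m, |x i.succ| < 1} := by
      simp only [Set.ofPred_forall]
      exact isOpen_iInter_of_finite fun i => isOpen_lt (by fun_prop) continuous_const
    exact h1.inter (isOpen_lt (by fun_prop) (continuous_coneBody_height m))
  refine ⟨0, mem_interior.2 ⟨_, fun x hx => ?_, hopen, ⟨by simp, ?_⟩⟩⟩
  · exact ⟨fun i => (hx.1 i).le, hx.2.le⟩
  have : 0 ≤ cubeFluctuation m fun i => (0 : EuclideanSpace ℝ (Fin (m + 1))) i.succ :=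
    Finset.sum_nonneg fun i _ => by simp; positivity
  simp only [PiLp.zero_apply, abs_zero] at *
  linarith

lemma neg_mem_coneBody {x : EuclideanSpace ℝ (Fin (m + 1))} : -x ∈ coneBody m ↔ x ∈ coneBody m := by
  simp [coneBody, cubeFluctuation]

/-- The point of `ℝ^{m+1}` with first coordinate `u` and remaining coordinates `y`. -/
noncomputable def euclideanCons (u : ℝ) (y : Fin m → ℝ) : EuclideanSpace ℝ (Fin (m + 1)) :=
  WithLp.toLp 2 (Fin.cons u y)

lemma measurePreserving_euclideanCons : MeasurePreserving
    (fun p : ℝ × (Fin m → ℝ) => euclideanCons m p.1 p.2) (volume.prod volume) volume := by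
  have h1 := (volume_preserving_piFinSuccAbove (fun _ : Fin (m + 1) => ℝ) 0).symm
  have h2 := (PiLp.volume_preserving_toLp (Fin (m + 1))).comp h1
  have e : (fun p : ℝ × (Fin m → ℝ) => euclideanCons m p.1 p.2) =
      WithLp.toLp 2 ∘ (MeasurableEquiv.piFinSuccAbove (fun _ : Fin (m + 1) => ℝ) 0).symm := by
    funext p
    simp [euclideanCons, MeasurableEquiv.piFinSuccAbove_symm_apply, Fin.consEquiv]
  rw [e]
  exact h2

@[fun_prop]
lemma measurable_euclideanCons :
    Measurable fun p : ℝ × (Fin m → ℝ) => euclideanCons m p.1 p.2 :=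
  (measurePreserving_euclideanCons m).measurable

lemma euclideanCons_mem_coneBody {u : ℝ} {y : Fin m → ℝ} : euclideanCons m u y ∈ coneBody m ↔
    (y ∈ Set.univ.pi fun _ => Set.Icc (-1 : ℝ) 1) ∧ |u| ≤ 3 + cubeFluctuation m y := by
  simp only [coneBody, Set.mem_ofPred_eq, euclideanCons, Fin.cons_succ, Fin.cons_zero,
    Set.mem_univ_pi, Set.mem_Icc, abs_le]

lemma norm_euclideanCons_sq (u : ℝ) (y : Fin m → ℝ) :
    ‖euclideanCons m u y‖ ^ 2 = u ^ 2 + ∑ i, y i ^ 2 := by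
  rw [EuclideanSpace.real_norm_sq_eq, Fin.sum_univ_succ]
  simp [euclideanCons]

/-- Disintegration of the Gaussian tilts of the uniform measure on the cone body. -/
lemma exists_lintegral_gaussianTilt_coneBody_eq {t : ℝ} (ht : 0 ≤ t) : ∃ c : ℝ≥0∞,
    ∀ F : EuclideanSpace ℝ (Fin (m + 1)) → ℝ≥0∞, Measurable F →
      ∫⁻ x, F x ∂(gaussianTilt (cond volume (coneBody m)) t) =
      c * ∫⁻ y, (∫⁻ u in {u : ℝ | |u| ≤ 3 + cubeFluctuation m y},
        ENNReal.ofReal (Real.exp (-(t * u ^ 2))) * F (euclideanCons m u y))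
          ∂(truncatedGaussianPi m t) := by
  have := isProbabilityMeasure_cond_volume (isCompact_coneBody m) (interior_coneBody_nonempty m)
  obtain ⟨c, hc⟩ := exists_lintegral_cube_eq m t
  set ν := cond volume (coneBody m)
  refine ⟨(ENNReal.ofReal (∫ x, Real.exp (-(t * ‖x‖ ^ 2)) ∂ν))⁻¹ * ((volume (coneBody m))⁻¹ * c),
    fun F hF => ?_⟩
  have hS : MeasurableSet {p : ℝ × (Fin m → ℝ) | |p.1| ≤ 3 + cubeFluctuation m p.2} :=
    measurableSet_le (by fun_prop) (by fun_prop)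
  have hSy : ∀ y : Fin m → ℝ, MeasurableSet {u : ℝ | |u| ≤ 3 + cubeFluctuation m y} := fun y =>
    measurableSet_le (by fun_prop) (by fun_prop)
  have hG : Measurable fun y => ∫⁻ u in {u | |u| ≤ 3 + cubeFluctuation m y},
      ENNReal.ofReal (Real.exp (-(t * u ^ 2))) * F (euclideanCons m u y) := by
    simp_rw [← lintegral_indicator (hSy _)]
    have : Measurable ({p : ℝ × (Fin m → ℝ) | |p.1| ≤ 3 + cubeFluctuation m p.2}.indicator
        fun p => ENNReal.ofReal (Real.exp (-(t * p.1 ^ 2))) * F (euclideanCons m p.1 p.2)) :=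
      Measurable.indicator (by fun_prop) hS
    exact this.lintegral_prod_left'
  have hI : Measurable ((coneBody m).indicator
      fun x => ENNReal.ofReal (Real.exp (-(t * ‖x‖ ^ 2))) * F x) :=
    Measurable.indicator (by fun_prop) (isCompact_coneBody m).measurableSet
  rw [lintegral_gaussianTilt _ ht, mul_assoc, mul_assoc]
  congr 1
  simp only [ν, ProbabilityTheory.cond]
  rw [lintegral_smul_measure, smul_eq_mul]
  congr 1
  rw [← hc _ hG, ← lintegral_indicator (isCompact_coneBody m).measurableSet,
    ← (measurePreserving_euclideanCons m).lintegral_comp hI,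
    lintegral_prod_symm' (f := fun p : ℝ × (Fin m → ℝ) => (coneBody m).indicator
      (fun x => ENNReal.ofReal (Real.exp (-(t * ‖x‖ ^ 2))) * F x) (euclideanCons m p.1 p.2))
      (hI.comp (measurable_euclideanCons m)),
    ← lintegral_indicator (MeasurableSet.univ_pi fun _ => measurableSet_Icc)]
  refine lintegral_congr fun y => ?_
  by_cases hy : y ∈ Set.univ.pi fun _ => Set.Icc (-1 : ℝ) 1
  · rw [Set.indicator_of_mem hy, ← lintegral_indicator (hSy y),
      ← lintegral_const_mul' _ _ (by simp)]
    refine lintegral_congr fun u => ?_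
    by_cases hu : |u| ≤ 3 + cubeFluctuation m y
    · rw [Set.indicator_of_mem ((euclideanCons_mem_coneBody m).2 ⟨hy, hu⟩),
        Set.indicator_of_mem (show u ∈ {u | |u| ≤ 3 + cubeFluctuation m y} from hu), ← mul_assoc,
        ← ENNReal.ofReal_mul (by positivity), ← Real.exp_add, norm_euclideanCons_sq]
      congr 3
      ring
    · rw [Set.indicator_of_notMem fun h => hu ((euclideanCons_mem_coneBody m).1 h).2,
        Set.indicator_of_notMem (show u ∉ {u | |u| ≤ 3 + cubeFluctuation m y} from hu), mul_zero]
  · rw [Set.indicator_of_notMem hy]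
    refine (lintegral_congr fun u => ?_).trans lintegral_zero
    exact Set.indicator_of_notMem (fun h => hy ((euclideanCons_mem_coneBody m).1 h).1) _

end ConeBody

/-! ### Moments of the body and of its tilts -/

section ConeBodyMoments

variable (m : ℕ)

lemma volume_abs_le (r : ℝ) : volume {u : ℝ | |u| ≤ r} = ENNReal.ofReal (2 * r) := by
  have : {u : ℝ | |u| ≤ r} = Set.Icc (-r) r := by ext u; simp [abs_le]
  rw [this, Real.volume_Icc]
  congr 1; ring

/-- If `t ≥ 1` or `m = 0` then `β ≤ 2` and the summand `1` suffices. Otherwise each coordinate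
contributes a mean shift of at least `t/40`, hence `S` has mean at least `t√n/80` with `n = m + 1`;
and `6400 = 80²`. -/
lemma sqrt_le_one_add_integral_cubeFluctuation {t β : ℝ} (ht : 0 ≤ t)
    (hβ : β ≤ 1 + t ^ 2 * (m + 1)) (htβ : t * β ≤ 1) :
    √(β / 6400) ≤ 1 + ∫ y, cubeFluctuation m y ∂(truncatedGaussianPi m t) := by
  rw [integral_cubeFluctuation]
  set d := ∫ y, (1 / 3 - y ^ 2) ∂(truncatedGaussian t)
  have hd := integral_third_sub_sq_ge ht
  have hd0 : 0 ≤ d := le_trans (by positivity) hd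
  set n : ℝ := m + 1
  have hn : 1 ≤ n := by simp [n]
  have hES : 0 ≤ m / √n * d := by positivity
  have hsmall : β ≤ 6400 → √(β / 6400) ≤ 1 + m / √n * d := fun h => by
    refine le_trans ?_ (le_add_of_nonneg_right hES)
    rw [Real.sqrt_le_left (by norm_num)]
    linarith
  rcases le_total 1 t with h1 | h1
  · refine hsmall ?_
    by_contra! hc
    nlinarith
  rcases Nat.eq_zero_or_pos m with hm | hm
  · refine hsmall (hβ.trans ?_)
    have : n = 1 := by simp [n, hm]
    rw [this]; nlinarith
  have hdt : t / 40 ≤ d := by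
    have h2 : 1 / 3 ≤ Real.exp (-t) := by
      have h3 : Real.exp (-1) ≤ Real.exp (-t) := Real.exp_le_exp.2 (by linarith)
      have h4 : 1 / 3 ≤ Real.exp (-1) := by
        rw [Real.exp_neg, ← one_div, one_div_le_one_div (by norm_num) (Real.exp_pos _)]
        linarith [Real.exp_one_lt_d9]
      linarith
    have h5 : t * (1 / 3) * (4 / 45) ≤ d := le_trans (by gcongr) hd
    linarith
  have hm1 : (1 : ℝ) ≤ m := by exact_mod_cast hm
  have hsq : √n ^ 2 = n := Real.sq_sqrt (by linarith)
  have hs0 : 0 < √n := Real.sqrt_pos.2 (by linarith)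
  have hmn : √n / 2 ≤ m / √n := by
    rw [div_le_div_iff₀ (by norm_num) hs0, ← sq, hsq]
    simp only [n]; linarith
  have hlow : t * √n / 80 ≤ m / √n * d := by
    calc t * √n / 80 = √n / 2 * (t / 40) := by ring
      _ ≤ _ := by gcongr
  refine Real.sqrt_le_iff.2 ⟨by linarith, ?_⟩
  have h6 : (1 + t * √n / 80) ^ 2 ≤ (1 + m / √n * d) ^ 2 := by gcongr
  refine le_trans ?_ h6
  have h7 : t ^ 2 * n = (t * √n) ^ 2 := by rw [mul_pow, hsq]
  rw [h7] at hβ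
  have h8 : 0 ≤ t * √n := by positivity
  nlinarith

/-- Lower bound for the second moment of the first coordinate under the tilts of the uniform
measure on the cone body. -/
lemma ofReal_le_lintegral_sq_coneBody {t β : ℝ} (ht : 0 ≤ t) (hβ0 : 0 < β)
    (hβ : β ≤ 1 + t ^ 2 * (m + 1)) (htβ : t * β ≤ 1) :
    ENNReal.ofReal (β / 819200) ≤
      ∫⁻ x, ENNReal.ofReal (x 0 ^ 2) ∂(gaussianTilt (cond volume (coneBody m)) t) := by
  have := isProbabilityMeasure_cond_volume (isCompact_coneBody m) (interior_coneBody_nonempty m)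
  have := isProbabilityMeasure_gaussianTilt (ν := cond volume (coneBody m)) ht
  obtain ⟨c, hc⟩ := exists_lintegral_gaussianTilt_coneBody_eq m ht
  set μ := gaussianTilt (cond volume (coneBody m)) t
  have hWS := measure_cubeFluctuation_ge (sqrt_le_one_add_integral_cubeFluctuation m ht hβ htβ)
  set W := √(β / 6400)
  have hW0 : 0 < W := Real.sqrt_pos.2 (by positivity)
  have hW2 : W ^ 2 = β / 6400 := Real.sq_sqrt (by positivity)
  have htW : t * W ^ 2 ≤ 1 := by rw [hW2]; linarith
  have h1 : 1 = c * ∫⁻ y, (∫⁻ u in {u : ℝ | |u| ≤ 3 + cubeFluctuation m y},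
      ENNReal.ofReal (Real.exp (-(t * u ^ 2)))) ∂(truncatedGaussianPi m t) := by
    simpa using hc (fun _ => 1) measurable_const
  set J := ∫⁻ y, (∫⁻ u in {u : ℝ | |u| ≤ 3 + cubeFluctuation m y},
      ENNReal.ofReal (Real.exp (-(t * u ^ 2)))) ∂(truncatedGaussianPi m t)
  -- With probability at least `3/4` the fibre contains `[-W, W]`, where the weight is at least `exp
  -- (-1)` because `t * W² ≤ 1`.
  have hJ : ENNReal.ofReal (W / 2) ≤ J := by
    have hmeas : MeasurableSet {y | W ≤ 3 + cubeFluctuation m y} :=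
      measurableSet_le measurable_const (by fun_prop)
    calc ENNReal.ofReal (W / 2)
        ≤ ENNReal.ofReal (Real.exp (-1) * (2 * W)) * ENNReal.ofReal (3 / 4) := by
          rw [← ENNReal.ofReal_mul (by positivity)]
          refine ENNReal.ofReal_le_ofReal ?_
          have h4 : 1 / 3 ≤ Real.exp (-1) := by
            rw [Real.exp_neg, ← one_div, one_div_le_one_div (by norm_num) (Real.exp_pos _)]
            linarith [Real.exp_one_lt_d9]
          nlinarith
      _ ≤ ENNReal.ofReal (Real.exp (-1) * (2 * W)) *
            (truncatedGaussianPi m t) {y | W ≤ 3 + cubeFluctuation m y} := by gcongr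
      _ = ∫⁻ y in {y | W ≤ 3 + cubeFluctuation m y},
            ENNReal.ofReal (Real.exp (-1) * (2 * W)) ∂(truncatedGaussianPi m t) := by
          rw [setLIntegral_const]
      _ ≤ ∫⁻ y in {y | W ≤ 3 + cubeFluctuation m y},
            (∫⁻ u in {u : ℝ | |u| ≤ 3 + cubeFluctuation m y},
              ENNReal.ofReal (Real.exp (-(t * u ^ 2)))) ∂(truncatedGaussianPi m t) := by
          refine setLIntegral_mono' hmeas fun y (hy : W ≤ _) => ?_
          calc ENNReal.ofReal (Real.exp (-1) * (2 * W))
              = ∫⁻ u in {u : ℝ | |u| ≤ W}, ENNReal.ofReal (Real.exp (-1)) := by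
                rw [setLIntegral_const, volume_abs_le, ENNReal.ofReal_mul (Real.exp_pos _).le]
            _ ≤ ∫⁻ u in {u : ℝ | |u| ≤ W}, ENNReal.ofReal (Real.exp (-(t * u ^ 2))) := by
                refine setLIntegral_mono' (measurableSet_le (by fun_prop) (by fun_prop))
                  fun u (hu : |u| ≤ W) => ?_
                refine ENNReal.ofReal_le_ofReal (Real.exp_le_exp.2 ?_)
                have h2 : u ^ 2 ≤ W ^ 2 := sq_le_sq.2 (hu.trans (le_abs_self _))
                have h3 : t * u ^ 2 ≤ t * W ^ 2 := by gcongr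
                linarith
            _ ≤ _ := lintegral_mono_set fun u (hu : |u| ≤ W) => hu.trans hy
      _ ≤ J := setLIntegral_le_lintegral _ _
  -- The slab `|x 0| ≤ a` has weight at most `2a = W/4`, half of the lower bound for `J`. So its
  -- probability is at most `1/2`, and the second moment is at least `a²/2 = W²/128`.
  set a := W / 8
  have hset : MeasurableSet {x : EuclideanSpace ℝ (Fin (m + 1)) | |x 0| ≤ a} :=
    measurableSet_le (by fun_prop) (by fun_prop)
  have hP : μ {x | |x 0| ≤ a} ≤ ENNReal.ofReal (1 / 2) := by
    rw [← lintegral_indicator_one hset, hc _ (measurable_one.indicator hset)]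
    have hle : ∫⁻ y, (∫⁻ u in {u : ℝ | |u| ≤ 3 + cubeFluctuation m y},
        ENNReal.ofReal (Real.exp (-(t * u ^ 2))) *
          {x : EuclideanSpace ℝ (Fin (m + 1)) | |x 0| ≤ a}.indicator 1 (euclideanCons m u y))
          ∂(truncatedGaussianPi m t) ≤ ENNReal.ofReal (2 * a) := by
      calc _ ≤ ∫⁻ y, ENNReal.ofReal (2 * a) ∂(truncatedGaussianPi m t) := by
            refine lintegral_mono fun y => ?_
            refine (setLIntegral_le_lintegral _ _).trans ?_
            rw [← volume_abs_le, ← lintegral_indicator_one (measurableSet_le (by fun_prop) (by fun_prop))]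
            refine lintegral_mono fun u => ?_
            by_cases hu : |u| ≤ a
            · rw [Set.indicator_of_mem (show u ∈ {u : ℝ | |u| ≤ a} from hu)]
              have h3 : Real.exp (-(t * u ^ 2)) ≤ 1 := by
                rw [Real.exp_le_one_iff]
                have : 0 ≤ t * u ^ 2 := by positivity
                linarith
              refine (mul_le_mul' (ENNReal.ofReal_le_one.2 h3)
                (Set.indicator_le_self' (fun _ _ => zero_le) _)).trans ?_
              simp
            · rw [Set.indicator_of_notMem (by simpa [euclideanCons] using hu), mul_zero]
              exact zero_le
        _ = _ := by simp
    calc _ ≤ c * ENNReal.ofReal (2 * a) := by gcongr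
      _ = c * ENNReal.ofReal (W / 2) * ENNReal.ofReal (1 / 2) := by
        rw [mul_assoc, ← ENNReal.ofReal_mul (by positivity)]
        congr 2
        simp only [a]; ring
      _ ≤ c * J * ENNReal.ofReal (1 / 2) := by gcongr
      _ = _ := by rw [← h1, one_mul]
  have hsum : ENNReal.ofReal (a ^ 2) ≤
      ∫⁻ x, ENNReal.ofReal (x 0 ^ 2) ∂μ + ENNReal.ofReal (a ^ 2) * ENNReal.ofReal (1 / 2) := by
    calc ENNReal.ofReal (a ^ 2) = ∫⁻ x, ENNReal.ofReal (a ^ 2) ∂μ := by simp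
      _ ≤ ∫⁻ x, (ENNReal.ofReal (x 0 ^ 2) +
            ENNReal.ofReal (a ^ 2) * {x | |x 0| ≤ a}.indicator 1 x) ∂μ := by
          refine lintegral_mono fun x => ?_
          by_cases hx : |x 0| ≤ a
          · rw [Set.indicator_of_mem (show x ∈ {x | |x 0| ≤ a} from hx)]
            simp
          · refine le_add_right (ENNReal.ofReal_le_ofReal ?_)
            rw [← sq_abs (x 0)]
            have : a < |x 0| := not_le.1 hx
            gcongr
      _ = ∫⁻ x, ENNReal.ofReal (x 0 ^ 2) ∂μ + ENNReal.ofReal (a ^ 2) * μ {x | |x 0| ≤ a} := by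
          rw [lintegral_add_left (by fun_prop), lintegral_const_mul' _ _ (by simp),
            lintegral_indicator_one hset]
      _ ≤ _ := by gcongr
  have h2 : ENNReal.ofReal (a ^ 2) =
      ENNReal.ofReal (β / 819200) + ENNReal.ofReal (a ^ 2) * ENNReal.ofReal (1 / 2) := by
    rw [← ENNReal.ofReal_mul (by positivity), ← ENNReal.ofReal_add (by positivity) (by positivity)]
    congr 1
    simp only [a]
    rw [div_pow, hW2]; ring
  have h3 : ENNReal.ofReal (a ^ 2) * ENNReal.ofReal (1 / 2) ≠ ⊤ := by finiteness
  exact (ENNReal.add_le_add_iff_right h3).1 (h2.symm.trans_le hsum)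

/-- Sub-Gaussian bound for functions controlled by the coordinates of the cone body. -/
lemma lintegral_exp_sq_coneBody_le {f : EuclideanSpace ℝ (Fin (m + 1)) → ℝ} (hf : Measurable f)
    {a : Fin m → ℝ} (ha : ∑ i, a i ^ 2 ≤ 1)
    (h : ∀ x, |f x| ≤ |x 0| + 2 * |cubeFluctuation m fun i => x i.succ| +
      |∑ i, a i * x i.succ| + 1) :
    ∫⁻ x, ENNReal.ofReal (Real.exp (f x ^ 2 / 11 ^ 2)) ∂(cond volume (coneBody m)) ≤
      ENNReal.ofReal (Real.exp 3) := by
  have := isProbabilityMeasure_cond_volume (isCompact_coneBody m) (interior_coneBody_nonempty m)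
  obtain ⟨c, hc⟩ := exists_lintegral_gaussianTilt_coneBody_eq m le_rfl
  rw [gaussianTilt_zero] at hc
  simp only [zero_mul, neg_zero, Real.exp_zero, ENNReal.ofReal_one, one_mul] at hc
  have h1 : 1 = c * ∫⁻ y, ENNReal.ofReal (2 * (3 + cubeFluctuation m y))
      ∂(truncatedGaussianPi m 0) := by
    have := hc (fun _ => 1) measurable_const
    simpa [volume_abs_le] using this
  set μ := truncatedGaussianPi m 0
  set S := cubeFluctuation m with hS
  have hSm : Measurable S := measurable_cubeFluctuation m
  -- The mean fibre length is at least `6` because `S` is centred; `ENNReal.ofReal` only increases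
  -- the integral by discarding negative values.
  have hJ : ENNReal.ofReal 6 ≤ ∫⁻ y, ENNReal.ofReal (2 * (3 + S y)) ∂μ := by
    have hSi : Integrable S μ := (memLp_cubeFluctuation m 0).integrable (by norm_num)
    have h6 : ∫ y, 2 * (3 + S y) ∂μ = 6 := by
      rw [integral_const_mul, integral_add (integrable_const _) hSi,
        integral_cubeFluctuation_zero]
      simp
      norm_num
    rw [← h6]
    refine (ENNReal.ofReal_le_ofReal (integral_mono
      (((integrable_const _).add hSi).const_mul _)
      (((integrable_const _).add hSi).const_mul _).pos_part fun y => le_max_left _ 0)).trans ?_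
    rw [ofReal_integral_eq_lintegral_ofReal (((integrable_const _).add hSi).const_mul _).pos_part
      (ae_of_all _ fun y => le_max_right _ _)]
    refine lintegral_mono fun y => ?_
    rw [ENNReal.ofReal_max, ENNReal.ofReal_zero, max_eq_left zero_le]
    rfl
  set b : (Fin m → ℝ) → ℝ := fun y => ∑ i, a i * y i
  have hbm : Measurable b := by fun_prop
  have hinner : ∀ y, ∫⁻ u in {u : ℝ | |u| ≤ 3 + S y},
      ENNReal.ofReal (Real.exp (f (euclideanCons m u y) ^ 2 / 11 ^ 2)) ≤
      ENNReal.ofReal (6 * Real.exp 1) * (ENNReal.ofReal (Real.exp (S y ^ 2)) +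
        ENNReal.ofReal (Real.exp (b y ^ 2 / 4))) := by
    intro y
    -- On the fibre `|u| ≤ 3 + |S|`, so `f² ≤ 3(16 + 9S² + b²)`. The scale `11` makes the three
    -- coefficients after division at most `1`, `1/4` and `1/8`.
    calc _ ≤ ∫⁻ u in {u : ℝ | |u| ≤ 3 + S y},
          ENNReal.ofReal (Real.exp (1 + S y ^ 2 / 4 + b y ^ 2 / 8)) := by
          refine setLIntegral_mono' (measurableSet_le (by fun_prop) (by fun_prop))
            fun u (hu : |u| ≤ 3 + S y) => ENNReal.ofReal_le_ofReal (Real.exp_le_exp.2 ?_)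
          have h2 := h (euclideanCons m u y)
          have h3 : |f (euclideanCons m u y)| ≤ 4 + 3 * |S y| + |b y| := by
            have e1 : (euclideanCons m u y) 0 = u := by simp [euclideanCons]
            have e2 : (fun i : Fin m => (euclideanCons m u y) i.succ) = y := by
              ext i; simp [euclideanCons]
            have e3 : ∑ i : Fin m, a i * (euclideanCons m u y) i.succ = b y := by
              simp [euclideanCons, b]
            rw [e1, e2, e3] at h2
            linarith [le_abs_self (S y)]
          have h4 : f (euclideanCons m u y) ^ 2 ≤ (4 + 3 * |S y| + |b y|) ^ 2 := by
            rw [← sq_abs]; gcongr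
          have h5 : (4 + 3 * |S y| + |b y|) ^ 2 ≤ 3 * (16 + 9 * S y ^ 2 + b y ^ 2) := by
            rw [← sq_abs (S y), ← sq_abs (b y)]
            nlinarith [sq_nonneg (4 - 3 * |S y|), sq_nonneg (4 - |b y|),
              sq_nonneg (3 * |S y| - |b y|)]
          rw [div_le_iff₀ (by norm_num)]
          nlinarith [sq_nonneg (S y), sq_nonneg (b y)]
      _ = ENNReal.ofReal (Real.exp (1 + S y ^ 2 / 4 + b y ^ 2 / 8)) *
            ENNReal.ofReal (2 * (3 + S y)) := by rw [setLIntegral_const, volume_abs_le]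
      _ ≤ _ := by
          rw [← ENNReal.ofReal_mul (by positivity), ← ENNReal.ofReal_add (by positivity) (by positivity),
            ← ENNReal.ofReal_mul (by positivity)]
          refine ENNReal.ofReal_le_ofReal ?_
          have h6 : 2 * (3 + S y) ≤ 12 * Real.exp (S y ^ 2 / 4) := by
            have := Real.add_one_le_exp (S y ^ 2 / 4)
            nlinarith [sq_nonneg (S y - 1)]
          have h7 : Real.exp (S y ^ 2) = (Real.exp (S y ^ 2 / 4) * Real.exp (S y ^ 2 / 4)) ^ 2 := by
            rw [← Real.exp_add, ← Real.exp_nat_mul]; congr 1; push_cast; ring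
          have h8 : Real.exp (b y ^ 2 / 4) = Real.exp (b y ^ 2 / 8) ^ 2 := by
            rw [← Real.exp_nat_mul]; congr 1; push_cast; ring
          rw [h7, h8, Real.exp_add, Real.exp_add]
          set p := Real.exp (S y ^ 2 / 4)
          set q := Real.exp (b y ^ 2 / 8)
          calc Real.exp 1 * p * q * (2 * (3 + S y)) ≤ Real.exp 1 * p * q * (12 * p) := by gcongr
            _ = 6 * Real.exp 1 * (2 * (p * p) * q) := by ring
            _ ≤ _ := by
              gcongr
              exact two_mul_le_add_sq _ _
  rw [hc _ (by fun_prop)]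
  calc _ ≤ c * ∫⁻ y, ENNReal.ofReal (6 * Real.exp 1) * (ENNReal.ofReal (Real.exp (S y ^ 2)) +
        ENNReal.ofReal (Real.exp (b y ^ 2 / 4))) ∂μ := by
        gcongr with y
        exact hinner y
    _ ≤ c * (ENNReal.ofReal (6 * Real.exp 1) * (2 + 2)) := by
        rw [lintegral_const_mul' _ _ ENNReal.ofReal_ne_top, lintegral_add_left (by fun_prop)]
        gcongr
        · exact lintegral_exp_cubeFluctuation_sq_le m
        · exact lintegral_exp_sum_mul_sq_le ha
    _ = c * ENNReal.ofReal 6 * (ENNReal.ofReal (4 * Real.exp 1)) := by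
        rw [ENNReal.ofReal_mul (by norm_num), ENNReal.ofReal_mul (p := 4) (by norm_num),
          ENNReal.ofReal_ofNat (n := 4)]
        ring
    _ ≤ c * (∫⁻ y, ENNReal.ofReal (2 * (3 + S y)) ∂μ) * (ENNReal.ofReal (4 * Real.exp 1)) := by
        gcongr
    _ = ENNReal.ofReal (4 * Real.exp 1) := by rw [← h1, one_mul]
    _ ≤ _ := by
        refine ENNReal.ofReal_le_ofReal ?_
        have h9 : Real.exp 3 = Real.exp 1 * Real.exp 1 * Real.exp 1 := by
          rw [← Real.exp_add, ← Real.exp_add]; norm_num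
        rw [h9]
        have := Real.exp_one_gt_d9
        nlinarith [Real.exp_pos 1]

end ConeBodyMoments

/-! ### Symmetric bodies, covariance from below, and dilations -/

section Symmetry

variable {n : ℕ} {K : Set (EuclideanSpace ℝ (Fin n))}

lemma integral_id_gaussianTilt_eq_zero (hK : MeasurableSet K) (hs : ∀ x, -x ∈ K ↔ x ∈ K) (t : ℝ) :
    ∫ x, x ∂(gaussianTilt (cond volume K) t) = 0 := by
  rw [gaussianTilt, integral_tilted]
  set Z := ∫ x, Real.exp (-(t * ‖x‖ ^ 2)) ∂(cond volume K)
  rw [ProbabilityTheory.cond, integral_smul_measure, ← integral_indicator hK]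
  set g := K.indicator fun x => (Real.exp (-(t * ‖x‖ ^ 2)) / Z) • x
  have hg : ∀ x, g (-x) = -g x := by
    intro x
    by_cases hx : x ∈ K
    · simp only [g]
      rw [Set.indicator_of_mem hx, Set.indicator_of_mem ((hs x).2 hx), norm_neg, smul_neg]
    · simp only [g]
      rw [Set.indicator_of_notMem hx, Set.indicator_of_notMem (mt (hs x).1 hx), neg_zero]
  have h := integral_neg_eq_self g volume
  simp_rw [hg] at h
  rw [integral_neg] at h
  have h2 : (2 : ℝ) • ∫ x, g x = 0 := by
    rw [two_smul]
    nth_rw 1 [← h]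
    simp
  rw [(smul_eq_zero.1 h2).resolve_left two_ne_zero, smul_zero]

lemma lintegral_sq_le_covOpNorm {μ : Measure (EuclideanSpace ℝ (Fin n))} [IsProbabilityMeasure μ]
    (hL : MemLp id 2 μ) (h0 : ∫ x, x ∂μ = 0) (i : Fin n) :
    ∫⁻ x, ENNReal.ofReal (x i ^ 2) ∂μ ≤ covOpNorm μ := by
  have h1 := covarianceBilin_apply hL (EuclideanSpace.single i 1) (EuclideanSpace.single i 1)
  simp only [id, h0, sub_zero, EuclideanSpace.inner_single_left, map_one, one_mul, ← sq] at h1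
  have hi : Integrable (fun x : EuclideanSpace ℝ (Fin n) => x i ^ 2) μ := by
    have := (hL.inner_const (EuclideanSpace.single i (1 : ℝ))).integrable_sq
    simpa [EuclideanSpace.inner_single_right] using this
  rw [← ofReal_integral_eq_lintegral_ofReal hi (ae_of_all _ fun x => sq_nonneg _), ← h1, covOpNorm,
    ← ofReal_norm]
  refine ENNReal.ofReal_le_ofReal ((le_abs_self _).trans ?_)
  have := (covarianceBilin μ).le_opNorm₂ (EuclideanSpace.single i 1) (EuclideanSpace.single i 1)
  simpa using this

variable {ν : Measure (EuclideanSpace ℝ (Fin n))} [IsProbabilityMeasure ν] {t a : ℝ}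

/-- Dilating by `a` and then tilting by `t` is tilting by `t * a²` and then dilating. -/
lemma lintegral_gaussianTilt_map_smul (ht : 0 ≤ t) {F : EuclideanSpace ℝ (Fin n) → ℝ≥0∞}
    (hF : Measurable F) :
    ∫⁻ x, F x ∂(gaussianTilt (ν.map fun x => a • x) t) =
      ∫⁻ x, F (a • x) ∂(gaussianTilt ν (t * a ^ 2)) := by
  have hm : Measurable fun x : EuclideanSpace ℝ (Fin n) => a • x := by fun_prop
  have : IsProbabilityMeasure (ν.map fun x => a • x) :=
    Measure.isProbabilityMeasure_map hm.aemeasurable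
  rw [lintegral_gaussianTilt _ ht, lintegral_gaussianTilt _ (by positivity),
    integral_map hm.aemeasurable (by fun_prop), lintegral_map (by fun_prop) hm]
  simp only [norm_smul, mul_pow, Real.norm_eq_abs, sq_abs, mul_assoc]

end Symmetry

/-! ### The normalized example -/

section Example

variable (m : ℕ)

/-- With `q` the norm of the cube part and `r = √(n/3)`, where `n = m + 1`, one has `r² - q² = 1/3 +
√n * S`. Dividing by `q + r ≥ r`, where `√n ≤ 2r` and `1/3 ≤ r`, gives `|q - r| ≤ 2|S| + 1`. -/
lemma abs_norm_sub_sqrt_le (x : EuclideanSpace ℝ (Fin (m + 1))) :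
    |‖x‖ - √(((m : ℝ) + 1) / 3)| ≤
      |x 0| + 2 * |cubeFluctuation m fun i => x i.succ| + 1 := by
  set S := cubeFluctuation m fun i => x i.succ with hS
  set n : ℝ := m + 1 with hn
  have hn1 : 1 ≤ n := by simp [n]
  set r := √(n / 3)
  have hr : r ^ 2 = n / 3 := Real.sq_sqrt (by positivity)
  have hr0 : 0 < r := Real.sqrt_pos.2 (by positivity)
  have hsn : √n ^ 2 = n := Real.sq_sqrt (by positivity)
  have hsn0 : 0 < √n := Real.sqrt_pos.2 (by positivity)
  set q := √(∑ i : Fin m, x i.succ ^ 2)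
  have hq0 : 0 ≤ q := Real.sqrt_nonneg _
  have hq : q ^ 2 = ∑ i : Fin m, x i.succ ^ 2 :=
    Real.sq_sqrt (Finset.sum_nonneg fun i _ => sq_nonneg _)
  have hx : ‖x‖ ^ 2 = x 0 ^ 2 + q ^ 2 := by
    rw [EuclideanSpace.real_norm_sq_eq, Fin.sum_univ_succ, hq]
  have hqS : q ^ 2 = m / 3 - √n * S := by
    have : √n * S = ∑ i : Fin m, (1 / 3 - x i.succ ^ 2) := by
      rw [hS, cubeFluctuation, Finset.mul_sum]
      refine Finset.sum_congr rfl fun i _ => ?_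
      rw [← hn]; field_simp
    rw [this, Finset.sum_sub_distrib, hq]
    simp
    ring
  have h1 : |‖x‖ - q| ≤ |x 0| := by
    have hqx : q ≤ ‖x‖ := by
      refine le_of_sq_le_sq ?_ (norm_nonneg x) |>.trans le_rfl
      rw [hx]; nlinarith [sq_nonneg (x 0)]
    rw [abs_of_nonneg (by linarith), ← sub_le_iff_le_add'.symm]
    refine abs_le_of_sq_le_sq' ?_ (by positivity) |>.2
    rw [hx, ← sq_abs (x 0)]
    nlinarith [mul_nonneg hq0 (abs_nonneg (x 0))]
  have hrn : √n ≤ 2 * r := by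
    refine abs_le_of_sq_le_sq' ?_ (by positivity) |>.2
    rw [mul_pow, hr, hsn]; linarith
  have hr3 : 1 / 3 ≤ r := by
    refine abs_le_of_sq_le_sq' ?_ (by positivity) |>.2
    rw [hr]; linarith
  have h2 : |q - r| ≤ 2 * |S| + 1 := by
    have h3 : |q - r| * (q + r) = |1 / 3 + √n * S| := by
      have e : 1 / 3 + √n * S = -((q - r) * (q + r)) := by
        have e2 : -((q - r) * (q + r)) = r ^ 2 - q ^ 2 := by ring
        rw [e2, hqS, hr]
        simp only [n]; ring
      rw [e, abs_neg, abs_mul, abs_of_nonneg (show 0 ≤ q + r by positivity)]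
    have h4 : |1 / 3 + √n * S| ≤ (2 * |S| + 1) * r := by
      refine (abs_add_le _ _).trans ?_
      rw [abs_mul, abs_of_pos hsn0, abs_of_pos (by norm_num : (0 : ℝ) < 1 / 3)]
      nlinarith [abs_nonneg S]
    have h5 : |q - r| * r ≤ (2 * |S| + 1) * r := by
      refine le_trans ?_ (h3.le.trans h4)
      gcongr; linarith
    exact le_of_mul_le_mul_right h5 hr0
  calc |‖x‖ - r| ≤ |‖x‖ - q| + |q - r| := abs_sub_le _ _ _
    _ ≤ _ := by linarith

lemma abs_inner_le {θ : EuclideanSpace ℝ (Fin (m + 1))} (hθ : ‖θ‖ = 1)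
    (x : EuclideanSpace ℝ (Fin (m + 1))) :
    |inner ℝ x θ| ≤ |x 0| + |∑ i : Fin m, θ i.succ * x i.succ| := by
  have h0 : |θ 0| ≤ 1 := by
    have := PiLp.norm_apply_le θ 0
    rwa [hθ, Real.norm_eq_abs] at this
  have e : inner ℝ x θ = θ 0 * x 0 + ∑ i : Fin m, θ i.succ * x i.succ := by
    rw [PiLp.inner_apply, Fin.sum_univ_succ]
    simp
  rw [e]
  refine (abs_add_le _ _).trans (add_le_add ?_ le_rfl)
  rw [abs_mul]
  exact mul_le_of_le_one_left (abs_nonneg _) h0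

lemma sum_succ_sq_le {θ : EuclideanSpace ℝ (Fin (m + 1))} (hθ : ‖θ‖ = 1) :
    ∑ i : Fin m, θ i.succ ^ 2 ≤ 1 := by
  have h := EuclideanSpace.real_norm_sq_eq θ
  rw [hθ, Fin.sum_univ_succ] at h
  nlinarith [sq_nonneg (θ 0)]

lemma lintegral_exp_inner_coneBody_le {θ : EuclideanSpace ℝ (Fin (m + 1))} (hθ : ‖θ‖ = 1) :
    ∫⁻ x, ENNReal.ofReal (Real.exp (inner ℝ x θ ^ 2 / 11 ^ 2)) ∂(cond volume (coneBody m)) ≤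
      ENNReal.ofReal (Real.exp 3) :=
  lintegral_exp_sq_coneBody_le m (by fun_prop) (sum_succ_sq_le m hθ) fun x => by
    have := abs_inner_le m hθ x
    have := abs_nonneg (cubeFluctuation m fun i => x i.succ)
    linarith

lemma lintegral_exp_norm_coneBody_le :
    ∫⁻ x, ENNReal.ofReal (Real.exp ((‖x‖ - √(((m : ℝ) + 1) / 3)) ^ 2 / 11 ^ 2))
      ∂(cond volume (coneBody m)) ≤ ENNReal.ofReal (Real.exp 3) :=
  lintegral_exp_sq_coneBody_le m (by fun_prop) (a := 0) (by simp) fun x => by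
    simpa using abs_norm_sub_sqrt_le m x

lemma integrable_norm_sq_coneBody :
    Integrable (fun x => ‖x‖ ^ 2) (cond volume (coneBody m)) := by
  have := isProbabilityMeasure_cond_volume (isCompact_coneBody m) (interior_coneBody_nonempty m)
  rw [ProbabilityTheory.cond]
  refine Integrable.smul_measure ?_ (ENNReal.inv_ne_top.2
    (Measure.measure_pos_of_nonempty_interior _ (interior_coneBody_nonempty m)).ne')
  exact (Continuous.continuousOn (by fun_prop)).integrableOn_compact (isCompact_coneBody m)

lemma integral_norm_sq_coneBody_bounds :
    ((m : ℝ) + 1) / (819200 * 4356) ≤ ∫ x, ‖x‖ ^ 2 ∂(cond volume (coneBody m)) ∧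
      ∫ x, ‖x‖ ^ 2 ∂(cond volume (coneBody m)) ≤ 727 * (m + 1) := by
  have := isProbabilityMeasure_cond_volume (isCompact_coneBody m) (interior_coneBody_nonempty m)
  have hi := integrable_norm_sq_coneBody m
  have hlow := ofReal_le_lintegral_sq_coneBody m (t := 0) (β := 1) le_rfl one_pos (by simp) (by simp)
  rw [gaussianTilt_zero] at hlow
  obtain ⟨h1, h2⟩ := integrable_sq_of_lintegral_exp_le (by norm_num) (by fun_prop)
    (lintegral_exp_norm_coneBody_le m)
  set ν := cond volume (coneBody m)
  set M := ∫ x, ‖x‖ ^ 2 ∂ν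
  set n : ℝ := m + 1 with hn
  have hn1 : 1 ≤ n := by simp [n]
  set r := √(n / 3)
  have hr : r ^ 2 = n / 3 := Real.sq_sqrt (by positivity)
  have hM0 : 1 / 819200 ≤ M := by
    rw [← ENNReal.ofReal_le_ofReal_iff (integral_nonneg fun x => sq_nonneg _),
      ofReal_integral_eq_lintegral_ofReal hi (ae_of_all _ fun x => sq_nonneg _)]
    refine hlow.trans (lintegral_mono fun x => ENNReal.ofReal_le_ofReal ?_)
    rw [EuclideanSpace.real_norm_sq_eq]
    exact Finset.single_le_sum (f := fun i => x i ^ 2) (fun j _ => sq_nonneg _) (Finset.mem_univ 0)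
  have hup : M ≤ ∫ x, (2 * r ^ 2 + 2 * (‖x‖ - r) ^ 2) ∂ν :=
    integral_mono hi ((integrable_const _).add (h1.const_mul _)) fun x => by
      change ‖x‖ ^ 2 ≤ 2 * r ^ 2 + 2 * (‖x‖ - r) ^ 2
      nlinarith [sq_nonneg (‖x‖ - 2 * r)]
  have hdown : r ^ 2 ≤ ∫ x, (2 * ‖x‖ ^ 2 + 2 * (‖x‖ - r) ^ 2) ∂ν := by
    have : ∫ x, r ^ 2 ∂ν ≤ ∫ x, (2 * ‖x‖ ^ 2 + 2 * (‖x‖ - r) ^ 2) ∂ν :=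
      integral_mono (integrable_const _) ((hi.const_mul _).add (h1.const_mul _)) fun x => by
        change r ^ 2 ≤ 2 * ‖x‖ ^ 2 + 2 * (‖x‖ - r) ^ 2
        nlinarith [sq_nonneg (2 * ‖x‖ - r)]
    simpa using this
  rw [integral_add (integrable_const _) (h1.const_mul _)] at hup
  rw [integral_add (hi.const_mul _) (h1.const_mul _), integral_const_mul, integral_const_mul]
    at hdown
  simp only [integral_const_mul, integral_const, probReal_univ, one_smul] at hup
  constructor
  -- In small dimension the first coordinate alone gives the bound. For `n ≥ 4356 = 6 * 726`, the
  -- error `726 = 2 * 3 * 11²` is at most half of `r² = n/3`.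
  · rw [div_le_iff₀ (by norm_num)]
    rcases le_total n 4356 with h | h
    · linarith
    · change r ^ 2 ≤ 2 * M + _ at hdown
      linarith
  · linarith

/-- The tightness example: a dilate of the cone body. -/
theorem exists_convexBody_covOpNorm_ge : ∃ c C : ℝ, 0 < c ∧ 1 ≤ C ∧
    ∀ m : ℕ, ∃ K : Set (EuclideanSpace ℝ (Fin (m + 1))),
      Convex ℝ K ∧ IsCompact K ∧ (interior K).Nonempty ∧
      ∫ x, x ∂(cond volume K) = 0 ∧ ∫ x, ‖x‖ ^ 2 ∂(cond volume K) = m + 1 ∧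
      sigmaSG (cond volume K) ^ 2 ≤ ENNReal.ofReal C ∧
      normDeviation (cond volume K) ^ 2 ≤ ENNReal.ofReal C ∧
      ∀ t β : ℝ, 0 ≤ t → 0 < β → β ≤ 1 + t ^ 2 * (m + 1) → t * β ≤ 1 →
        ENNReal.ofReal (c * β) ≤ covOpNorm (gaussianTilt (cond volume K) t) := by
  -- The dilation satisfies `1/727 ≤ a² ≤ 819200 * 4356`. The upper constant is the square of the
  -- `Ψ₂` bound `11 * a * √24`.
  refine ⟨1 / 727 * ((1 / 727) ^ 2 / (819200 * 4356) / 819200), 121 * 24 * (819200 * 4356),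
    by positivity, by norm_num, fun m => ?_⟩
  have hν₀ := isProbabilityMeasure_cond_volume (isCompact_coneBody m) (interior_coneBody_nonempty m)
  obtain ⟨hM1, hM2⟩ := integral_norm_sq_coneBody_bounds m
  have hi₀ := integrable_norm_sq_coneBody m
  set n : ℝ := m + 1 with hn
  have hn1 : 1 ≤ n := by simp [n]
  set M := ∫ x, ‖x‖ ^ 2 ∂(cond volume (coneBody m)) with hM
  have hM0 : 0 < M := lt_of_lt_of_le (by positivity) hM1
  obtain ⟨a, ha, ha2⟩ : ∃ a : ℝ, 0 < a ∧ a ^ 2 = n / M :=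
    ⟨√(n / M), Real.sqrt_pos.2 (by positivity), Real.sq_sqrt (by positivity)⟩
  have hal : 1 / 727 ≤ a ^ 2 := by
    rw [ha2, div_le_div_iff₀ (by norm_num) hM0]; linarith
  have hau : a ^ 2 ≤ 819200 * 4356 := by
    rw [ha2, div_le_iff₀ hM0]
    rw [div_le_iff₀ (by norm_num)] at hM1
    linarith
  have hK := (isCompact_coneBody m).smul a
  have hKi : (interior (a • coneBody m)).Nonempty := by
    rw [interior_smul₀ ha.ne']
    exact (interior_coneBody_nonempty m).smul_set
  have hprob := isProbabilityMeasure_cond_volume hK hKi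
  have hKs : ∀ x, -x ∈ a • coneBody m ↔ x ∈ a • coneBody m := fun x => by
    rw [Set.mem_smul_set_iff_inv_smul_mem₀ ha.ne', Set.mem_smul_set_iff_inv_smul_mem₀ ha.ne',
      smul_neg, neg_mem_coneBody]
  have hmap := cond_volume_smul (isCompact_coneBody m).measurableSet ha
  have hm : Measurable fun x : EuclideanSpace ℝ (Fin (m + 1)) => a • x := by fun_prop
  have hzero := integral_id_gaussianTilt_eq_zero hK.measurableSet hKs
  have hb : ∫ x, x ∂(cond volume (a • coneBody m)) = 0 := by
    have := hzero 0
    rwa [gaussianTilt_zero] at this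
  have hpsi : ∀ f : EuclideanSpace ℝ (Fin (m + 1)) → ℝ, Measurable f →
      ∀ g : EuclideanSpace ℝ (Fin (m + 1)) → ℝ,
      (∀ x, f (a • x) = a * g x) →
      ∫⁻ x, ENNReal.ofReal (Real.exp (g x ^ 2 / 11 ^ 2)) ∂(cond volume (coneBody m)) ≤
        ENNReal.ofReal (Real.exp 3) →
      ∫⁻ x, ENNReal.ofReal (Real.exp (f x ^ 2 / (a * 11) ^ 2)) ∂(cond volume (a • coneBody m)) ≤
        ENNReal.ofReal (Real.exp 3) := by
    intro f hf g hfg hg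
    rw [hmap, lintegral_map (by fun_prop) hm]
    simp_rw [hfg, mul_pow]
    simpa only [mul_div_mul_left _ _ (pow_pos ha 2).ne'] using hg
  have hbound : ENNReal.ofReal (a * 11 * √(8 * 3)) ^ 2 ≤
      ENNReal.ofReal (121 * 24 * (819200 * 4356)) := by
    rw [← ENNReal.ofReal_pow (by positivity)]
    refine ENNReal.ofReal_le_ofReal ?_
    have h24 : √(8 * 3 : ℝ) ^ 2 = 8 * 3 := Real.sq_sqrt (by norm_num)
    rw [mul_pow, mul_pow, h24]
    linarith
  have hi : Integrable (fun x => ‖x‖ ^ 2) (cond volume (a • coneBody m)) := by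
    rw [hmap, integrable_map_measure (by fun_prop) hm.aemeasurable]
    simpa [Function.comp_def, norm_smul, mul_pow] using hi₀.const_mul (a ^ 2)
  refine ⟨a • coneBody m, (convex_coneBody m).smul a, hK, hKi, hb, ?_, ?_, ?_, ?_⟩
  · rw [hmap, integral_map hm.aemeasurable (by fun_prop)]
    simp only [norm_smul, mul_pow, Real.norm_eq_abs, sq_abs]
    rw [integral_const_mul, ← hM, ha2]
    field_simp
  · refine le_trans (pow_le_pow_left' (iSup₂_le fun θ hθ => ?_) 2) hbound
    have hθ : ‖θ‖ = 1 := by simpa using hθ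
    have hL : MemLp id 2 (cond volume (a • coneBody m)) := by
      rwa [memLp_two_iff_integrable_sq_norm (by fun_prop)]
    exact psi2Norm_inner_sub_le hL (s := a * 11) (a := 3) (by positivity) (by norm_num) θ
      (hpsi (fun x => inner ℝ x θ) (by fun_prop) (fun x => inner ℝ x θ)
        (fun x => real_inner_smul_left _ _ _) (lintegral_exp_inner_coneBody_le m hθ))
  · refine le_trans (pow_le_pow_left' ?_ 2) hbound
    have h1 := psi2Norm_sub_integral_le (f := fun x => ‖x‖ - a * √(n / 3))
      (μ := cond volume (a • coneBody m)) (s := a * 11) (a := 3) (by positivity)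
      (by norm_num) (by fun_prop) (hpsi _ (by fun_prop) _ (fun x => by
        rw [norm_smul, Real.norm_of_nonneg ha.le, mul_sub]) (lintegral_exp_norm_coneBody_le m))
    have hiN : Integrable (fun x => ‖x‖) (cond volume (a • coneBody m)) :=
      integrable_of_integrable_sq (by fun_prop) hi
    rw [integral_sub hiN (integrable_const _)] at h1
    simpa [normDeviation] using h1
  · intro t β ht hβ0 hβ htβ
    have hpt := isProbabilityMeasure_gaussianTilt (ν := cond volume (a • coneBody m)) ht
    have ha0 : 0 ≤ a ^ 2 := sq_nonneg a
    -- Shrinking `β` by this factor keeps both constraints valid when `t` is replaced by `t * a²`.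
    have h1 := ofReal_le_lintegral_sq_coneBody m (t := t * a ^ 2)
      (β := (1 / 727) ^ 2 / (819200 * 4356) * β) (by positivity) (by positivity) ?_ ?_
    · calc _ ≤ ENNReal.ofReal (a ^ 2 * ((1 / 727) ^ 2 / (819200 * 4356) * β / 819200)) := by
            refine ENNReal.ofReal_le_ofReal ?_
            calc _ = 1 / 727 * ((1 / 727) ^ 2 / (819200 * 4356) * β / 819200) := by ring
              _ ≤ _ := by gcongr
        _ ≤ ENNReal.ofReal (a ^ 2) * ∫⁻ x, ENNReal.ofReal (x 0 ^ 2)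
              ∂(gaussianTilt (cond volume (coneBody m)) (t * a ^ 2)) := by
            rw [ENNReal.ofReal_mul ha0]
            gcongr
        _ = ∫⁻ x, ENNReal.ofReal (x 0 ^ 2) ∂(gaussianTilt (cond volume (a • coneBody m)) t) := by
            rw [hmap, lintegral_gaussianTilt_map_smul ht (by fun_prop),
              ← lintegral_const_mul' _ _ (by simp)]
            refine lintegral_congr fun x => ?_
            rw [← ENNReal.ofReal_mul ha0, PiLp.smul_apply, smul_eq_mul, mul_pow]
        _ ≤ _ := lintegral_sq_le_covOpNorm (memLp_gaussianTilt ht hi) (hzero t) 0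
    · rw [← hn]
      have h2 : (1 / 727 : ℝ) ^ 2 ≤ (a ^ 2) ^ 2 := by gcongr
      have h3 : 0 ≤ t ^ 2 * n := by positivity
      have h4 : (1 / 727 : ℝ) ^ 2 / (819200 * 4356) * β ≤ (1 / 727) ^ 2 * β := by
        refine mul_le_mul_of_nonneg_right ?_ hβ0.le
        exact div_le_self (by norm_num) (by norm_num)
      have h5 : (1 / 727 : ℝ) ^ 2 * (t ^ 2 * n) ≤ (a ^ 2) ^ 2 * (t ^ 2 * n) := by gcongr
      nlinarith
    · have h2 : t * β * a ^ 2 ≤ 1 * (819200 * 4356) := by gcongr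
      calc _ = (1 / 727) ^ 2 * (t * β * a ^ 2 / (819200 * 4356)) := by ring
        _ ≤ (1 / 727) ^ 2 * 1 := by
          gcongr
          rw [div_le_one (by norm_num)]
          linarith
        _ ≤ 1 := by norm_num

end Example

/-! ### Conclusion -/

lemma min_one_add_inv_eq_ofReal {t : ℝ} (ht : 0 ≤ t) (n : ℕ) :
    ∃ β : ℝ, 0 < β ∧ β ≤ 1 + t ^ 2 * n ∧ t * β ≤ 1 ∧
      min (1 + ENNReal.ofReal t ^ 2 * n) (ENNReal.ofReal t)⁻¹ = ENNReal.ofReal β := by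
  have e : (1 + ENNReal.ofReal t ^ 2 * n) = ENNReal.ofReal (1 + t ^ 2 * n) := by
    rw [ENNReal.ofReal_add (by norm_num) (by positivity), ENNReal.ofReal_mul (by positivity),
      ENNReal.ofReal_pow ht, ENNReal.ofReal_one, ENNReal.ofReal_natCast]
  rcases ht.eq_or_lt with rfl | ht
  · exact ⟨1, by norm_num, by simp, by simp, by simp⟩
  · refine ⟨min (1 + t ^ 2 * n) t⁻¹, by positivity, min_le_left _ _, ?_, ?_⟩
    · calc t * min (1 + t ^ 2 * n) t⁻¹ ≤ t * t⁻¹ := by gcongr; exact min_le_right _ _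
        _ = 1 := mul_inv_cancel₀ ht.ne'
    · rw [e, ← ENNReal.ofReal_inv_of_pos ht, ENNReal.ofReal_min]

theorem mainTheorem7 :
    -- the upper bound, with `1 / t = ∞` for `t = 0`
    (∃ C : ℝ, 0 < C ∧
      ∀ (n : ℕ) (ν : Measure (EuclideanSpace ℝ (Fin n))), IsProbabilityMeasure ν →
        IsLogConcave ν → ∫ x, x ∂ν = 0 → ∫ x, ‖x‖ ^ 2 ∂ν = n →
        ∀ t : ℝ, 0 ≤ t →
          covOpNorm (gaussianTilt ν t) ≤ sigmaSG (gaussianTilt ν t) ^ 2 ∧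
          sigmaSG (gaussianTilt ν t) ^ 2 ≤ ENNReal.ofReal C *
            min (sigmaSG ν ^ 2 * (1 + ENNReal.ofReal t ^ 2 * n * normDeviation ν ^ 2))
              (ENNReal.ofReal t)⁻¹) ∧
    -- its tightness in every dimension, simultaneously for all `t`
    (∃ c C : ℝ, 0 < c ∧ 0 < C ∧
      ∀ n : ℕ, 1 ≤ n → ∃ ν : Measure (EuclideanSpace ℝ (Fin n)),
        (∃ K : Set (EuclideanSpace ℝ (Fin n)),
          Convex ℝ K ∧ IsCompact K ∧ (interior K).Nonempty ∧ ν = cond volume K) ∧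
        IsProbabilityMeasure ν ∧ IsLogConcave ν ∧
        ∫ x, x ∂ν = 0 ∧ ∫ x, ‖x‖ ^ 2 ∂ν = n ∧
        sigmaSG ν ^ 2 ≤ ENNReal.ofReal C ∧ normDeviation ν ^ 2 ≤ ENNReal.ofReal C ∧
        ∀ t : ℝ, 0 ≤ t →
          ENNReal.ofReal c *
              min (sigmaSG ν ^ 2 * (1 + ENNReal.ofReal t ^ 2 * n * normDeviation ν ^ 2))
                (ENNReal.ofReal t)⁻¹ ≤ covOpNorm (gaussianTilt ν t) ∧
          ENNReal.ofReal c * min (1 + ENNReal.ofReal t ^ 2 * n) (ENNReal.ofReal t)⁻¹ ≤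
            covOpNorm (gaussianTilt ν t)) := by
  refine ⟨⟨960, by norm_num, fun n ν hp hν hb hn t ht => ?_⟩, ?_⟩
  · have := isProbabilityMeasure_gaussianTilt (ν := ν) ht
    exact ⟨covOpNorm_le_sigmaSG_sq, sigmaSG_gaussianTilt_sq_le_min hν hb hn ht⟩
  · obtain ⟨c, C, hc, hC, H⟩ := exists_convexBody_covOpNorm_ge
    have hC0 : 0 < C := by linarith
    -- As `σ²` and `L²` are at most `C` with `C ≥ 1`, the first minimum exceeds the second by a
    -- factor of at most `C²`.
    refine ⟨c / C ^ 2, C, by positivity, hC0, fun n hn => ?_⟩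
    obtain ⟨m, rfl⟩ : ∃ m, n = m + 1 := ⟨n - 1, by omega⟩
    obtain ⟨K, hKc, hK, hKi, hb, h2, hσ, hL, hcov⟩ := H m
    refine ⟨cond volume K, ⟨K, hKc, hK, hKi, rfl⟩, isProbabilityMeasure_cond_volume hK hKi,
      isLogConcave_cond_volume hKc hK hKi, hb, by exact_mod_cast h2, hσ, hL, fun t ht => ?_⟩
    obtain ⟨β, hβ0, hβ, htβ, hmin⟩ := min_one_add_inv_eq_ofReal ht (m + 1)
    have hlow := hcov t β ht hβ0 (by exact_mod_cast hβ) htβ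
    rw [ENNReal.ofReal_mul hc.le, ← hmin] at hlow
    constructor
    · refine le_trans ?_ hlow
      have hC1 : 1 ≤ ENNReal.ofReal C := ENNReal.one_le_ofReal.2 hC
      have hle : min (sigmaSG (cond volume K) ^ 2 *
          (1 + ENNReal.ofReal t ^ 2 * (m + 1 : ℕ) * normDeviation (cond volume K) ^ 2))
          (ENNReal.ofReal t)⁻¹ ≤ ENNReal.ofReal C ^ 2 *
            min (1 + ENNReal.ofReal t ^ 2 * (m + 1 : ℕ)) (ENNReal.ofReal t)⁻¹ := by
        rw [mul_min]
        refine min_le_min ?_ (le_mul_of_one_le_left' (one_le_pow_of_one_le' hC1 2))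
        calc _ ≤ ENNReal.ofReal C *
              (ENNReal.ofReal C + ENNReal.ofReal t ^ 2 * (m + 1 : ℕ) * ENNReal.ofReal C) := by
              gcongr
          _ = _ := by ring
      calc _ ≤ ENNReal.ofReal (c / C ^ 2) * (ENNReal.ofReal C ^ 2 *
            min (1 + ENNReal.ofReal t ^ 2 * (m + 1 : ℕ)) (ENNReal.ofReal t)⁻¹) := by gcongr
        _ = _ := by
          rw [← mul_assoc, ← ENNReal.ofReal_pow hC0.le, ← ENNReal.ofReal_mul (by positivity),
            div_mul_cancel₀ _ (by positivity)]
    · refine le_trans ?_ hlow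
      gcongr
      exact div_le_self hc.le (one_le_pow₀ hC)
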